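/- \textbf{Setting.} Let $B$ be a unital complex $*$-algebra and $(\Omega^\bullet,\mathrm d)$ a differential $*$-calculus over $B$ of total degree $2n$: a graded algebra $\Omega^\bullet=\bigoplus_{k\ge0}\Omega^k$ with $\Omega^0=B$, $\Omega^{2n}\ne0$ and $\Omega^k=0$ for $k>2n$, generated by the elements $b,\mathrm db$ ($b\in B$), with a differential $\mathrm d$ of degree $1$, $\mathrm d^2=0$, satisfying the graded Leibniz rule, and with a conjugate linear involution $*$ extending that of $B$, such that $(\mathrm d\omega)^*=\mathrm d(\omega^*)$ and $(\omega\wedge\nu)^*=(-1)^{kl}\nu^*\wedge\omega^*$ for $\omega\in\Omega^k$, $\nu\in\Omega^l$. Let $(\Omega^{(\bullet,\bullet)},\kappa)$ be a Kähler structure: an algebra grading of $\Omega^\bullet$ by $\mathbb Z_{\ge0}^2$ with $\Omega^k=\bigoplus_{a+b=k}\Omega^{(a,b)}$, $(\Omega^{(a,b)})^*=\Omega^{(b,a)}$ and $\mathrm d=\partial+\bar\partial$ for maps $\partial$, $\bar\partial$ of bidegrees $(1,0)$, $(0,1)$, together with a central real form $\kappa\in\Omega^{(1,1)}$ with $\mathrm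 d\kappa=0$ such that, for $L(\omega)=\kappa\wedge\omega$, the map $L^{n-k}:\Omega^k\to\Omega^{2n-k}$ is bijective for all $0\le k<n$. Let $*_\kappa$ be the Hodge map $$*_\kappa(L^j\omega)=(-1)^{\frac{k(k+1)}2}\,\mathbf i^{\,a-b}\,\frac{j!}{(n-j-k)!}\,L^{n-j-k}\omega ,\qquad \omega\in\Omega^{(a,b)},\ L^{n-k+1}\omega=0,\ k=a+b,\ j+k\le n,$$ let $\Lambda:=*_\kappa^{-1}\circ L\circ *_\kappa$, and let $g:\Omega^\bullet\times\Omega^\bullet\to B$ be the metric for which distinct degrees are orthogonal and $g(\omega,\nu)=*_\kappa(\omega\wedge *_\kappa(\nu^*))$ for $\omega,\nu\in\Omega^k$. Let $\mathbf f:B\to\mathbb C$ be a state, i.e. a linear map with $\mathbf f(b^*b)>0$ for all $b\ne0$, and suppose that the integral $\int:=\mathbf f\circ *_\kappa:\Omega^{2n}\to\mathbb C$ is closed, i.e. $\int\mathrm d\omega=0$ for all $\omega\in\Omega^{2n-1}$. Let $(\mathcal F,h,\bar\partial_{\mathcal F})$ be a Hermitian holomorphic module: $\mathcal F$ is a finitely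 generated projective left $B$-module; $\bar\partial_{\mathcal F}:\mathcal F\to\Omega^{(0,1)}\otimes_B\mathcal F$ is a flat $(0,1)$-connection; and $h:\mathcal F\times\mathcal F\to B$ satisfies $h(f,k)=h(k,f)^*$, is left $B$-linear in $f$ and conjugate linear in $k$ with $h(f,bk)=h(f,k)b^*$, is such that $k\mapsto h(\cdot,k)$ is a bijection onto ${}_B\mathrm{Hom}(\mathcal F,B)$, and $h(f,f)$ is a non-zero finite sum of elements $b_i^*b_i$ for every $f\ne0$. A connection $\nabla:\mathcal F\to\Omega^1\otimes_B\mathcal F$ is \emph{Hermitian} if $\mathrm d\,h(f,k)=h(\nabla f,1\otimes k)+h(1\otimes f,\nabla k)$, where $h(\omega\otimes f,\nu\otimes k):=\omega\,h(f,k)\wedge\nu^*$; a \emph{Chern connection} is a Hermitian connection whose $(0,1)$-part is $\bar\partial_{\mathcal F}$, and $\partial_{\mathcal F}$ denotes its $(1,0)$-part. Extend $\nabla,\partial_{\mathcal F},\bar\partial_{\mathcal F}$ to $\Omega^\bullet\otimes_B\mathcal F$ by the rule $\nabla(\omega\otimes f)=\mathrm d\omega\otimes f+(-1)^{|\omega|}\omega\wedge\nabla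 f$ (with $\mathrm d$ replaced by $\partial$, $\bar\partial$ respectively), put $\Lambda_{\mathcal F}:=\Lambda\otimes\mathrm{id}$, and let $\langle\omega\otimes f,\nu\otimes k\rangle_{\mathcal F}:=\mathbf f\big(g(\omega\,h(f,k),\nu)\big)$. \textbf{Statement.} $\Lambda$ is an adjoint of $L$ with respect to $g$, and there is exactly one Chern connection $\nabla$. The operators $\partial_{\mathcal F}$, $\bar\partial_{\mathcal F}$ and $\nabla$ have adjoints $\partial_{\mathcal F}^\dagger$, $\bar\partial_{\mathcal F}^\dagger$ and $\nabla^\dagger=\partial_{\mathcal F}^\dagger+\bar\partial_{\mathcal F}^\dagger$ with respect to $\langle\cdot,\cdot\rangle_{\mathcal F}$, which are the only adjoints whenever $\langle\cdot,\cdot\rangle_{\mathcal F}$ is non-degenerate (in particular if it is an inner product), such that for $$\Delta_\nabla:=\nabla\nabla^\dagger+\nabla^\dagger\nabla,\qquad \Delta_{\partial_{\mathcal F}}:=(\partial_{\mathcal F}+\partial_{\mathcal F}^\dagger)^2,\qquad \Delta_{\bar\partial_{\mathcal F}}:=(\bar\partial_{\mathcal F}+\bar\partial_{\mathcal F}^\dagger)^2$$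 the following identities hold on $\Omega^\bullet\otimes_B\mathcal F$: $$\Delta_\nabla=\Delta_{\partial_{\mathcal F}}+\Delta_{\bar\partial_{\mathcal F}}=2\Delta_{\partial_{\mathcal F}}-[\Lambda_{\mathcal F},\mathbf i\nabla^2]=2\Delta_{\bar\partial_{\mathcal F}}+[\Lambda_{\mathcal F},\mathbf i\nabla^2].$$ -/

import Mathlib

open scoped TensorProduct

noncomputable section

namespace NCGeom

/-! ### Differential calculi and complex structures -/

/-- A differential calculus over the algebra `B`: a differential graded algebra `(Ω, d)`, graded by
the subspaces `deg k`, whose degree zero part is (the image under `incl` of) `B`, and which is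
generated as an algebra by the elements `b` and `d b`, for `b ∈ B`. -/
structure DifferentialCalculus (B Ω : Type*) [Ring B] [Algebra ℂ B] [Ring Ω] [Algebra ℂ Ω] where
  incl : B →ₐ[ℂ] Ω
  incl_injective : Function.Injective incl
  deg : ℕ → Submodule ℂ Ω
  graded : GradedAlgebra deg
  deg_zero : LinearMap.range incl.toLinearMap = deg 0
  d : Ω →ₗ[ℂ] Ω
  d_mem : ∀ k, ∀ ω ∈ deg k, d ω ∈ deg (k + 1)
  d_d : ∀ ω, d (d ω) = 0
  d_mul : ∀ k, ∀ ω ∈ deg k, ∀ ν, d (ω * ν) = d ω * ν + (-1 : ℂ) ^ k • (ω * d ν)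
  generated : Algebra.adjoin ℂ (Set.range incl ∪ Set.range (fun b => d (incl b))) = ⊤

attribute [instance] DifferentialCalculus.graded

/-- A differential `*`-calculus over the `*`-algebra `B`; `conj` is the extension of the `*`-map
of `B` to a conjugate linear involution of `Ω`. -/
structure DifferentialStarCalculus (B Ω : Type*) [Ring B] [StarRing B] [Algebra ℂ B]
    [StarModule ℂ B] [Ring Ω] [Algebra ℂ Ω] extends DifferentialCalculus B Ω where
  conj : Ω →ₛₗ[starRingEnd ℂ] Ω
  conj_conj : ∀ ω, conj (conj ω) = ω
  conj_incl : ∀ b, conj (incl b) = incl (star b)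
  conj_mul : ∀ k l, ∀ ω ∈ deg k, ∀ ν ∈ deg l,
    conj (ω * ν) = (-1 : ℂ) ^ (k * l) • (conj ν * conj ω)
  conj_d : ∀ ω, conj (d ω) = d (conj ω)

/-- A complex structure on a differential `*`-calculus: an algebra grading `bideg` by pairs of
natural numbers, refining the degree and compatible with the `*`-map, such that `d` is the sum of a
map `del` of bidegree `(1, 0)` and a map `delbar` of bidegree `(0, 1)` (which are then uniquely
determined). -/
structure ComplexStructure {B Ω : Type*} [Ring B] [StarRing B] [Algebra ℂ B]
    [StarModule ℂ B] [Ring Ω] [Algebra ℂ Ω] (C : DifferentialStarCalculus B Ω) where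
  bideg : ℕ × ℕ → Submodule ℂ Ω
  bigraded : GradedAlgebra bideg
  deg_eq : ∀ k, C.deg k = ⨆ (p : ℕ × ℕ) (_ : p.1 + p.2 = k), bideg p
  conj_mem : ∀ a b ω, C.conj ω ∈ bideg (b, a) ↔ ω ∈ bideg (a, b)
  del : Ω →ₗ[ℂ] Ω
  delbar : Ω →ₗ[ℂ] Ω
  d_eq : C.d = del + delbar
  del_mem : ∀ a b, ∀ ω ∈ bideg (a, b), del ω ∈ bideg (a + 1, b)
  delbar_mem : ∀ a b, ∀ ω ∈ bideg (a, b), delbar ω ∈ bideg (a, b + 1)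

attribute [instance] ComplexStructure.bigraded

/-- A Hermitian structure on a differential `*`-calculus of total degree `2n`: a complex structure
together with a central real `(1, 1)`-form `κ` such that multiplication by `κ ^ (n - k)` is an
isomorphism from `k`-forms to `(2n - k)`-forms, for all `k < n`. -/
structure HermitianStructure {B Ω : Type*} [Ring B] [StarRing B] [Algebra ℂ B]
    [StarModule ℂ B] [Ring Ω] [Algebra ℂ Ω] (C : DifferentialStarCalculus B Ω) (n : ℕ)
    extends ComplexStructure C where
  top_ne : C.deg (2 * n) ≠ ⊥
  above_top : ∀ k, 2 * n < k → C.deg k = ⊥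
  κ : Ω
  κ_mem : κ ∈ bideg (1, 1)
  κ_central : ∀ ω, κ * ω = ω * κ
  κ_real : C.conj κ = κ
  lefschetz_bijOn : ∀ k < n,
    Set.BijOn (fun ω => κ ^ (n - k) * ω) (C.deg k) (C.deg (2 * n - k))

/-- A Kähler structure is a Hermitian structure whose Hermitian form is closed. -/
structure KaehlerStructure {B Ω : Type*} [Ring B] [StarRing B] [Algebra ℂ B]
    [StarModule ℂ B] [Ring Ω] [Algebra ℂ Ω] (C : DifferentialStarCalculus B Ω) (n : ℕ)
    extends HermitianStructure C n where
  κ_closed : C.d κ = 0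

/-! ### Elementary operators on forms -/

namespace DifferentialCalculus

variable {B Ω : Type*} [Ring B] [Algebra ℂ B] [Ring Ω] [Algebra ℂ Ω]
  (C : DifferentialCalculus B Ω)

/-- The degree `k` component of a form. -/
def proj (k : ℕ) : Ω →ₗ[ℂ] Ω := GradedAlgebra.proj C.deg k

lemma proj_same {k : ℕ} {ω : Ω} (h : ω ∈ C.deg k) : C.proj k ω = ω :=
  DirectSum.decompose_of_mem_same _ h

lemma proj_ne {k l : ℕ} {ω : Ω} (h : ω ∈ C.deg k) (hkl : k ≠ l) : C.proj l ω = 0 :=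
  DirectSum.decompose_of_mem_ne _ h hkl

lemma proj_mem (k : ℕ) (ω : Ω) : C.proj k ω ∈ C.deg k :=
  (DirectSum.decompose C.deg ω k).2

/-- The operator acting on `deg k` as multiplication by the scalar `c k`. -/
def scale (c : ℕ → ℂ) : Ω →ₗ[ℂ] Ω :=
  (DirectSum.toModule ℂ ℕ Ω fun k => c k • (C.deg k).subtype) ∘ₗ
    (DirectSum.decomposeLinearEquiv C.deg).toLinearMap

lemma scale_of_mem (c : ℕ → ℂ) {k : ℕ} {ω : Ω} (h : ω ∈ C.deg k) : C.scale c ω = c k • ω := by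
  simp only [scale, LinearMap.comp_apply, LinearEquiv.coe_coe,
    DirectSum.decomposeLinearEquiv_apply]
  rw [DirectSum.decompose_of_mem _ h, ← DirectSum.lof_eq_of ℂ, DirectSum.toModule_lof]
  rfl

/-- The parity operator `ω ↦ (-1)^|ω| ω`. -/
def parity : Ω →ₗ[ℂ] Ω := C.scale fun k => (-1) ^ k

lemma parity_of_mem {k : ℕ} {ω : Ω} (h : ω ∈ C.deg k) : C.parity ω = (-1 : ℂ) ^ k • ω :=
  C.scale_of_mem _ h

lemma incl_mem (b : B) : C.incl b ∈ C.deg 0 := by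
  rw [← C.deg_zero]; exact ⟨b, rfl⟩

/-- The degree zero component of a form, as an element of `B`. -/
def toBase : Ω →ₗ[ℂ] B :=
  (LinearEquiv.ofInjective C.incl.toLinearMap C.incl_injective).symm.toLinearMap ∘ₗ
    (C.proj 0).codRestrict (LinearMap.range C.incl.toLinearMap)
      (fun ω => by rw [C.deg_zero]; exact C.proj_mem 0 ω)

lemma toBase_incl (b : B) : C.toBase (C.incl b) = b := by
  simp only [toBase, LinearMap.comp_apply, LinearEquiv.coe_coe]
  rw [LinearEquiv.symm_apply_eq]
  apply Subtype.ext
  exact C.proj_same (C.incl_mem b)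

lemma induction {motive : Ω → Prop} (hz : motive 0)
    (hb : ∀ k, ∀ ω ∈ C.deg k, motive ω)
    (ha : ∀ ω ν, motive ω → motive ν → motive (ω + ν)) (ω : Ω) : motive ω :=
  DirectSum.Decomposition.inductionOn C.deg hz (fun m => hb _ _ m.2) ha ω

lemma mul_incl_mem {k : ℕ} {ω : Ω} (hω : ω ∈ C.deg k) (b : B) : ω * C.incl b ∈ C.deg k := by
  have : ω * C.incl b ∈ C.deg (k + 0) := SetLike.GradedMul.mul_mem hω (C.incl_mem b)
  simpa using this

lemma d_mul_incl (ω : Ω) (b : B) :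
    C.d (ω * C.incl b) = C.d ω * C.incl b + C.parity ω * C.d (C.incl b) := by
  induction ω using C.induction with
  | hz => simp
  | hb k ω h => rw [C.d_mul _ ω h, C.parity_of_mem h, smul_mul_assoc]
  | ha ω ν h1 h2 => simp only [add_mul, map_add, h1, h2]; abel

lemma parity_parity (ω : Ω) : C.parity (C.parity ω) = ω := by
  induction ω using C.induction with
  | hz => simp
  | hb k ω h =>
    rw [C.parity_of_mem h, map_smul, C.parity_of_mem h, smul_smul, ← mul_pow]
    simp
  | ha ω ν h1 h2 => simp [h1, h2]

lemma parity_mul_incl (ω : Ω) (b : B) : C.parity (ω * C.incl b) = C.parity ω * C.incl b := by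
  induction ω using C.induction with
  | hz => simp
  | hb k ω h => rw [C.parity_of_mem h, C.parity_of_mem (C.mul_incl_mem h b), smul_mul_assoc]
  | ha ω ν h1 h2 => simp only [add_mul, map_add, h1, h2]

lemma proj_mul_incl (k : ℕ) (ω : Ω) (b : B) :
    C.proj k (ω * C.incl b) = C.proj k ω * C.incl b := by
  induction ω using C.induction with
  | hz => simp
  | hb l ω h =>
    have h2 := C.mul_incl_mem h b
    by_cases hq : l = k
    · subst hq; rw [C.proj_same h, C.proj_same h2]
    · rw [C.proj_ne h hq, C.proj_ne h2 hq, zero_mul]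
  | ha ω ν h1 h2 => simp [add_mul, h1, h2]

end DifferentialCalculus

lemma DifferentialStarCalculus.conj_mul_incl {B Ω : Type*} [Ring B] [StarRing B] [Algebra ℂ B]
    [StarModule ℂ B] [Ring Ω] [Algebra ℂ Ω] (C : DifferentialStarCalculus B Ω) (ω : Ω) (b : B) :
    C.conj (ω * C.incl b) = C.incl (star b) * C.conj ω := by
  induction ω using C.induction with
  | hz => simp
  | hb k ω h => rw [C.conj_mul _ 0 _ h _ (C.incl_mem b), C.conj_incl]; simp
  | ha ω ν h1 h2 => simp [add_mul, mul_add, h1, h2]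

section ComplexStructure

namespace ComplexStructure

variable {B Ω : Type*} [Ring B] [StarRing B] [Algebra ℂ B] [StarModule ℂ B]
  [Ring Ω] [Algebra ℂ Ω] {C : DifferentialStarCalculus B Ω} (K : ComplexStructure C)

/-- The projection of forms onto their component of bidegree `p`. -/
def biproj (p : ℕ × ℕ) : Ω →ₗ[ℂ] Ω := GradedAlgebra.proj K.bideg p

lemma biproj_same {p : ℕ × ℕ} {ω : Ω} (h : ω ∈ K.bideg p) : K.biproj p ω = ω :=
  DirectSum.decompose_of_mem_same _ h

lemma biproj_ne {p q : ℕ × ℕ} {ω : Ω} (h : ω ∈ K.bideg p) (hpq : p ≠ q) : K.biproj q ω = 0 :=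
  DirectSum.decompose_of_mem_ne _ h hpq

lemma biproj_mem (p : ℕ × ℕ) (ω : Ω) : K.biproj p ω ∈ K.bideg p :=
  (DirectSum.decompose K.bideg ω p).2

lemma bideg_le (p : ℕ × ℕ) : K.bideg p ≤ C.deg (p.1 + p.2) := by
  rw [K.deg_eq]
  exact le_iSup₂_of_le p rfl le_rfl

lemma bideg_zero : K.bideg (0, 0) = C.deg 0 := by
  rw [K.deg_eq]
  refine le_antisymm (le_iSup₂_of_le (0, 0) rfl le_rfl) (iSup₂_le fun p hp => ?_)
  rw [show p = (0, 0) from Prod.ext (by simp only; omega) (by simp only; omega)]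

lemma incl_mem (b : B) : C.incl b ∈ K.bideg (0, 0) := by
  rw [K.bideg_zero]; exact C.incl_mem b

lemma induction {motive : Ω → Prop} (hz : motive 0)
    (hb : ∀ p, ∀ ω ∈ K.bideg p, motive ω)
    (ha : ∀ ω ν, motive ω → motive ν → motive (ω + ν)) (ω : Ω) : motive ω :=
  DirectSum.Decomposition.inductionOn K.bideg hz (fun m => hb _ _ m.2) ha ω

lemma mul_mem {p q : ℕ × ℕ} {ω ν : Ω} (hω : ω ∈ K.bideg p) (hν : ν ∈ K.bideg q) :
    ω * ν ∈ K.bideg (p + q) := SetLike.GradedMul.mul_mem hω hν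

lemma mul_incl_mem {p : ℕ × ℕ} {ω : Ω} (hω : ω ∈ K.bideg p) (b : B) :
    ω * C.incl b ∈ K.bideg p := by
  have := K.mul_mem hω (K.incl_mem b)
  rwa [Prod.mk_zero_zero, add_zero] at this

lemma incl_mul_mem {p : ℕ × ℕ} {ω : Ω} (hω : ω ∈ K.bideg p) (b : B) :
    C.incl b * ω ∈ K.bideg p := by
  have := K.mul_mem (K.incl_mem b) hω
  rwa [Prod.mk_zero_zero, zero_add] at this

lemma biproj_mul_incl (p : ℕ × ℕ) (ω : Ω) (b : B) :
    K.biproj p (ω * C.incl b) = K.biproj p ω * C.incl b := by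
  induction ω using K.induction with
  | hz => simp
  | hb q ω h =>
    by_cases hqp : q = p
    · subst hqp; rw [K.biproj_same h, K.biproj_same (K.mul_incl_mem h b)]
    · rw [K.biproj_ne h hqp, K.biproj_ne (K.mul_incl_mem h b) hqp, zero_mul]
  | ha ω ν h1 h2 => simp [add_mul, h1, h2]

lemma biproj_incl_mul (p : ℕ × ℕ) (ω : Ω) (b : B) :
    K.biproj p (C.incl b * ω) = C.incl b * K.biproj p ω := by
  induction ω using K.induction with
  | hz => simp
  | hb q ω h =>
    by_cases hqp : q = p
    · subst hqp; rw [K.biproj_same h, K.biproj_same (K.incl_mul_mem h b)]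
    · rw [K.biproj_ne h hqp, K.biproj_ne (K.incl_mul_mem h b) hqp, mul_zero]
  | ha ω ν h1 h2 => simp [mul_add, h1, h2]

lemma separate {p q : ℕ × ℕ} (hpq : p ≠ q) {x x' y y' : Ω} (hx : x ∈ K.bideg p)
    (hx' : x' ∈ K.bideg p) (hy : y ∈ K.bideg q) (hy' : y' ∈ K.bideg q)
    (h : x + y = x' + y') : x = x' ∧ y = y' := by
  have h1 := congrArg (K.biproj p) h
  rw [map_add, map_add, K.biproj_same hx, K.biproj_same hx', K.biproj_ne hy hpq.symm,
    K.biproj_ne hy' hpq.symm, add_zero, add_zero] at h1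
  exact ⟨h1, by subst h1; exact add_left_cancel h⟩

lemma del_delbar_mul_incl (ω : Ω) (b : B) :
    K.del (ω * C.incl b) = K.del ω * C.incl b + C.parity ω * K.del (C.incl b) ∧
    K.delbar (ω * C.incl b) = K.delbar ω * C.incl b + C.parity ω * K.delbar (C.incl b) := by
  induction ω using K.induction with
  | hz => simp
  | hb p ω h =>
    obtain ⟨a, c⟩ := p
    have hb := K.incl_mem b
    have e := C.d_mul_incl ω b
    rw [C.parity_of_mem (K.bideg_le _ h)] at e ⊢
    refine K.separate (p := (a + 1, c)) (q := (a, c + 1)) (by simp)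
      (K.del_mem _ _ _ (K.mul_incl_mem h b)) ?_ (K.delbar_mem _ _ _ (K.mul_incl_mem h b)) ?_ ?_
    · refine add_mem (K.mul_incl_mem (K.del_mem _ _ _ h) b) ?_
      rw [smul_mul_assoc]
      exact Submodule.smul_mem _ _ (by simpa using K.mul_mem h (K.del_mem _ _ _ hb))
    · refine add_mem (K.mul_incl_mem (K.delbar_mem _ _ _ h) b) ?_
      rw [smul_mul_assoc]
      exact Submodule.smul_mem _ _ (by simpa using K.mul_mem h (K.delbar_mem _ _ _ hb))
    · rw [K.d_eq] at e
      simp only [LinearMap.add_apply, add_mul, mul_add] at e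
      rw [e]; abel
  | ha ω ν h1 h2 =>
    simp only [add_mul, map_add, h1.1, h1.2, h2.1, h2.2]
    constructor <;> abel

lemma del_incl_mul (b c : B) : K.del (C.incl (b * c)) =
    K.del (C.incl b) * C.incl c + C.incl b * K.del (C.incl c) := by
  have := (K.del_delbar_mul_incl (C.incl b) c).1
  rw [C.parity_of_mem (C.incl_mem b)] at this
  simpa using this

lemma biproj_one_zero_d_incl (b : B) : K.biproj (1, 0) (C.d (C.incl b)) = K.del (C.incl b) := by
  rw [K.d_eq, LinearMap.add_apply, map_add,
    K.biproj_same (K.del_mem 0 0 _ (K.incl_mem b)),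
    K.biproj_ne (K.delbar_mem 0 0 _ (K.incl_mem b)) (by simp), add_zero]

end ComplexStructure

end ComplexStructure

/-! ### Lefschetz decomposition, Hodge map, metric -/

namespace HermitianStructure

variable {B Ω : Type*} [Ring B] [StarRing B] [Algebra ℂ B] [StarModule ℂ B]
  [Ring Ω] [Algebra ℂ Ω] {C : DifferentialStarCalculus B Ω} {n : ℕ}
  (K : HermitianStructure C n)

/-- The Lefschetz operator `L(ω) = κ ∧ ω`. -/
def lefschetz : Ω →ₗ[ℂ] Ω := LinearMap.mulLeft ℂ K.κ

/-- The primitive forms of bidegree `p`, for `p.1 + p.2 ≤ n`. -/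
def primitive (p : ℕ × ℕ) : Submodule ℂ Ω :=
  K.bideg p ⊓ LinearMap.ker (K.lefschetz ^ (n + 1 - (p.1 + p.2)))

/-- The indices `((a, b), j)` of the Lefschetz decomposition into the spaces `L ^ j P^(a, b)`. -/
abbrev LefschetzIndex (n : ℕ) : Type := {i : (ℕ × ℕ) × ℕ // i.1.1 + i.1.2 + i.2 ≤ n}

/-- The map `⨁ P^(a, b) → Ω`, given by `L ^ j` on the summand of index `((a, b), j)`. -/
def assemble : (DirectSum (LefschetzIndex n) fun i => K.primitive i.1.1) →ₗ[ℂ] Ω :=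
  DirectSum.toModule ℂ (LefschetzIndex n) Ω fun i =>
    (K.lefschetz ^ i.1.2) ∘ₗ (K.primitive i.1.1).subtype

lemma lefschetz_pow_apply (m : ℕ) (ω : Ω) : (K.lefschetz ^ m) ω = K.κ ^ m * ω := by
  simp [lefschetz, LinearMap.pow_mulLeft]

lemma lefschetz_pow_mem (m : ℕ) {p : ℕ × ℕ} {ω : Ω} (h : ω ∈ K.bideg p) :
    (K.lefschetz ^ m) ω ∈ K.bideg (p.1 + m, p.2 + m) := by
  rw [lefschetz_pow_apply]
  have := K.mul_mem (SetLike.pow_mem_graded m K.κ_mem) h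
  have e : m • ((1, 1) : ℕ × ℕ) + p = (p.1 + m, p.2 + m) := by
    ext <;> simp [add_comm]
  rwa [e] at this

lemma lefschetz_pow_pow (m l : ℕ) (ω : Ω) :
    (K.lefschetz ^ m) ((K.lefschetz ^ l) ω) = (K.lefschetz ^ (m + l)) ω := by
  rw [pow_add]; rfl

lemma lefschetz_pow_eq_zero {p : ℕ × ℕ} {ω : Ω} (h : ω ∈ K.primitive p) {m : ℕ}
    (hm : n + 1 ≤ p.1 + p.2 + m) : (K.lefschetz ^ m) ω = 0 := by
  obtain ⟨r, rfl⟩ : ∃ r, m = r + (n + 1 - (p.1 + p.2)) := ⟨m - (n + 1 - (p.1 + p.2)), by omega⟩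
  rw [← lefschetz_pow_pow, show (K.lefschetz ^ (n + 1 - (p.1 + p.2))) ω = 0 from h.2, map_zero]

lemma lefschetz_pow_injective {k m : ℕ} (hk : k + m ≤ n) {ω : Ω} (h : ω ∈ C.deg k)
    (h0 : (K.lefschetz ^ m) ω = 0) : ω = 0 := by
  rcases Nat.eq_zero_or_pos m with rfl | hm
  · simpa using h0
  refine (K.lefschetz_bijOn k (by omega)).injOn h (zero_mem _) ?_
  obtain ⟨r, hr⟩ : ∃ r, n - k = r + m := ⟨n - k - m, by omega⟩
  simp only [← lefschetz_pow_apply, hr, ← lefschetz_pow_pow, h0, map_zero]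

lemma assemble_injective : Function.Injective K.assemble := by
  classical
  suffices h : ∀ x, K.assemble x = 0 → x = 0 from fun x y hxy =>
    sub_eq_zero.mp (h _ ((K.assemble.map_sub x y).trans (sub_eq_zero.mpr hxy)))
  intro x hx
  by_contra hne
  have hs : (DFinsupp.support x).Nonempty := by
    rw [Finset.nonempty_iff_ne_empty, Ne, DFinsupp.support_eq_empty]; exact hne
  obtain ⟨i, hi, hmax⟩ := Finset.exists_max_image (DFinsupp.support x) (fun i => i.1.2) hs
  have hsum : ∑ l ∈ DFinsupp.support x, (K.lefschetz ^ l.1.2) (x l : Ω) = 0 := by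
    rw [← hx]
    conv_rhs => rw [← DirectSum.sum_support_of x]
    rw [map_sum]
    refine Finset.sum_congr rfl fun l _ => ?_
    rw [assemble, ← DirectSum.lof_eq_of ℂ, DirectSum.toModule_lof]; rfl
  have hprim : ∀ l, (x l : Ω) ∈ K.primitive l.1.1 := fun l => (x l).2
  have hbi : ∀ l, (x l : Ω) ∈ K.bideg l.1.1 := fun l => (x l).2.1
  have hin := i.2
  have key : (K.lefschetz ^ (n - (i.1.1.1 + i.1.1.2) - i.1.2))
      (K.biproj (i.1.1.1 + i.1.2, i.1.1.2 + i.1.2)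
        (∑ l ∈ DFinsupp.support x, (K.lefschetz ^ l.1.2) (x l : Ω))) =
      (K.lefschetz ^ (n - (i.1.1.1 + i.1.1.2))) (x i : Ω) := by
    rw [map_sum, map_sum, Finset.sum_eq_single i]
    · rw [K.biproj_same (K.lefschetz_pow_mem _ (hbi i)), lefschetz_pow_pow]
      congr 2; omega
    · intro l hl hli
      have hj := hmax l hl
      by_cases hb : (l.1.1.1 + l.1.2, l.1.1.2 + l.1.2) = (i.1.1.1 + i.1.2, i.1.1.2 + i.1.2)
      · rw [← hb, K.biproj_same (K.lefschetz_pow_mem _ (hbi l)), lefschetz_pow_pow]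
        simp only [Prod.mk.injEq] at hb
        refine K.lefschetz_pow_eq_zero (hprim l) ?_
        have : l.1.2 ≠ i.1.2 := by
          intro h
          apply hli
          apply Subtype.ext
          ext <;> omega
        omega
      · rw [K.biproj_ne (K.lefschetz_pow_mem _ (hbi l)) hb, map_zero]
    · intro h; exact absurd hi h
  rw [hsum, map_zero, map_zero] at key
  have : (x i : Ω) = 0 :=
    K.lefschetz_pow_injective (by omega) (K.bideg_le _ (hbi i)) key.symm
  exact (DFinsupp.mem_support_iff.mp hi) (Subtype.ext this)

lemma assemble_of (i : LefschetzIndex n) (ω : K.primitive i.1.1) :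
    K.assemble (DirectSum.lof ℂ (LefschetzIndex n) (fun i => K.primitive i.1.1) i ω) =
      (K.lefschetz ^ i.1.2) ω := by
  rw [assemble, DirectSum.toModule_lof]; rfl

lemma lefschetz_pow_mem_range {p : ℕ × ℕ} {ω : Ω} (h : ω ∈ K.primitive p)
    (_ : p.1 + p.2 ≤ n) (j : ℕ) : (K.lefschetz ^ j) ω ∈ LinearMap.range K.assemble := by
  by_cases hj : p.1 + p.2 + j ≤ n
  · exact ⟨_, K.assemble_of ⟨(p, j), hj⟩ ⟨ω, h⟩⟩
  · rw [K.lefschetz_pow_eq_zero h (by omega)]; exact zero_mem _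

lemma lefschetz_mem_range (m : ℕ) {ω : Ω} (h : ω ∈ LinearMap.range K.assemble) :
    (K.lefschetz ^ m) ω ∈ LinearMap.range K.assemble := by
  obtain ⟨x, rfl⟩ := h
  induction x using DirectSum.induction_on with
  | zero => simp
  | of i ω =>
    rw [← DirectSum.lof_eq_of ℂ, assemble_of, lefschetz_pow_pow]
    exact K.lefschetz_pow_mem_range ω.2 (by have := i.2; omega) _
  | add x y hx hy => rw [map_add, map_add]; exact add_mem hx hy

lemma biproj_lefschetz_pow (m : ℕ) (p : ℕ × ℕ) (ω : Ω) :
    K.biproj (p.1 + m, p.2 + m) ((K.lefschetz ^ m) ω) = (K.lefschetz ^ m) (K.biproj p ω) := by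
  induction ω using K.toComplexStructure.induction with
  | hz => simp
  | hb q ω h =>
    by_cases hqp : q = p
    · subst hqp; rw [K.biproj_same h, K.biproj_same (K.lefschetz_pow_mem m h)]
    · rw [K.biproj_ne h hqp, K.biproj_ne (K.lefschetz_pow_mem m h), map_zero]
      intro e
      simp only [Prod.mk.injEq, add_left_inj] at e
      exact hqp (Prod.ext e.1 e.2)
  | ha ω ν h1 h2 => simp [h1, h2]

lemma deg_le_range (k : ℕ) (hk : k ≤ n) : C.deg k ≤ LinearMap.range K.assemble := by
  classical
  induction k using Nat.strong_induction_on with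
  | _ k ih =>
    -- a form of degree `k` killed by `L ^ (n + 1 - k)` has primitive components
    have hprim : ∀ ω ∈ C.deg k, (K.lefschetz ^ (n + 1 - k)) ω = 0 →
        ω ∈ LinearMap.range K.assemble := by
      intro ω hω h0
      rw [← DirectSum.sum_support_decompose K.bideg ω]
      refine sum_mem fun p _ => ?_
      change K.biproj p ω ∈ _
      by_cases hp : p.1 + p.2 = k
      · have := K.lefschetz_pow_mem_range (p := p) (ω := K.biproj p ω)
          ⟨K.biproj_mem p ω, ?_⟩ (by omega) 0
        · simpa using this
        · change (K.lefschetz ^ (n + 1 - (p.1 + p.2))) _ = 0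
          rw [hp, ← K.biproj_lefschetz_pow, h0, map_zero]
      · have : K.biproj p ω = 0 := by
          rw [K.deg_eq] at hω
          suffices h : (⨆ (q : ℕ × ℕ) (_ : q.1 + q.2 = k), K.bideg q) ≤ LinearMap.ker (K.biproj p) from
            h hω
          refine iSup₂_le fun q hq ν hν => K.biproj_ne hν ?_
          rintro rfl
          exact hp hq
        rw [this]; exact zero_mem _
    have hL : ∀ m l, ∀ ω ∈ C.deg l, (K.lefschetz ^ m) ω ∈ C.deg (l + 2 * m) := by
      intro m l ω hω
      rw [lefschetz_pow_apply]
      have h2 : K.κ ∈ C.deg 2 := K.bideg_le _ K.κ_mem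
      have h3 : K.κ ^ m * ω ∈ C.deg (m • 2 + l) :=
        SetLike.GradedMul.mul_mem (SetLike.pow_mem_graded m h2) hω
      convert h3 using 2
      simp only [smul_eq_mul]; omega
    intro α hα
    have hα' := hL (n + 1 - k) k α hα
    by_cases hk2 : k < 2
    · refine hprim α hα ?_
      rw [K.above_top _ (by omega)] at hα'
      exact (Submodule.mem_bot ℂ).mp hα'
    · obtain ⟨β, hβ, hβe⟩ := (K.lefschetz_bijOn (k - 2) (by omega)).surjOn
        (show (K.lefschetz ^ (n + 1 - k)) α ∈ C.deg (2 * n - (k - 2)) by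
          convert hα' using 2; omega)
      simp only [← lefschetz_pow_apply] at hβe
      have hLβ : (K.lefschetz ^ 1) β ∈ C.deg k := by
        have := hL 1 (k - 2) β hβ
        convert this using 2; omega
      have e : α = (α - (K.lefschetz ^ 1) β) + (K.lefschetz ^ 1) β := by abel
      rw [e]
      refine add_mem (hprim _ (sub_mem hα hLβ) ?_)
        (K.lefschetz_mem_range 1 (ih (k - 2) (by omega) (by omega) hβ))
      rw [map_sub, lefschetz_pow_pow, ← hβe, sub_eq_zero]
      congr 2; omega

lemma assemble_surjective : Function.Surjective K.assemble := by
  classical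
  intro ω
  rw [← LinearMap.mem_range, ← DirectSum.sum_support_decompose C.deg ω]
  refine sum_mem fun k _ => ?_
  have hk : (DirectSum.decompose C.deg ω k : Ω) ∈ C.deg k := SetLike.coe_mem _
  generalize (DirectSum.decompose C.deg ω k : Ω) = ν at hk
  by_cases h1 : k ≤ n
  · exact K.deg_le_range k h1 hk
  by_cases h2 : k ≤ 2 * n
  · obtain ⟨β, hβ, rfl⟩ := (K.lefschetz_bijOn (2 * n - k) (by omega)).surjOn
      (show ν ∈ C.deg (2 * n - (2 * n - k)) by
        rwa [show 2 * n - (2 * n - k) = k by omega])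
    simp only [← lefschetz_pow_apply]
    exact K.lefschetz_mem_range _ (K.deg_le_range _ (by omega) hβ)
  · rw [K.above_top k (by omega)] at hk
    rw [(Submodule.mem_bot ℂ).mp hk]; exact zero_mem _

/-- The Lefschetz decomposition of forms. -/
def lefschetzEquiv : (DirectSum (LefschetzIndex n) fun i => K.primitive i.1.1) ≃ₗ[ℂ] Ω :=
  LinearEquiv.ofBijective K.assemble ⟨K.assemble_injective, K.assemble_surjective⟩

/-- The coefficient `(-1)^(k(k+1)/2) i^(a-b) j!/(n-j-k)!`, where `k = a + b`, of the Weil formula. -/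
def hodgeCoeff (n a b j : ℕ) : ℂ :=
  (-1) ^ ((a + b) * (a + b + 1) / 2) * Complex.I ^ ((a : ℤ) - (b : ℤ)) *
    ((j.factorial : ℂ) / ((n - j - (a + b)).factorial : ℂ))

/-- The Hodge map, given by `*(L ^ j ω) = hodgeCoeff n a b j • L ^ (n - j - (a + b)) ω` for `ω` a
primitive form of bidegree `(a, b)` and `a + b + j ≤ n`. -/
def hodge : Ω →ₗ[ℂ] Ω :=
  (DirectSum.toModule ℂ (LefschetzIndex n) Ω fun i =>
    hodgeCoeff n i.1.1.1 i.1.1.2 i.1.2 •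
      ((K.lefschetz ^ (n - i.1.2 - (i.1.1.1 + i.1.1.2))) ∘ₗ (K.primitive i.1.1).subtype)) ∘ₗ
    K.lefschetzEquiv.symm.toLinearMap

lemma hodge_apply {a b j : ℕ} {ω : Ω} (h : ω ∈ K.primitive (a, b)) (hj : a + b + j ≤ n) :
    K.hodge ((K.lefschetz ^ j) ω) =
      hodgeCoeff n a b j • (K.lefschetz ^ (n - j - (a + b))) ω := by
  have e : (K.lefschetz ^ j) ω = K.lefschetzEquiv
      (DirectSum.lof ℂ (LefschetzIndex n) (fun i => K.primitive i.1.1) ⟨((a, b), j), hj⟩ ⟨ω, h⟩) :=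
    (K.assemble_of ⟨((a, b), j), hj⟩ ⟨ω, h⟩).symm
  rw [hodge, LinearMap.comp_apply, e, LinearEquiv.coe_coe, LinearEquiv.symm_apply_apply,
    DirectSum.toModule_lof]
  rfl

lemma lefschetz_induction {motive : Ω → Prop} (hz : motive 0)
    (hb : ∀ a b j ω, ω ∈ K.primitive (a, b) → a + b + j ≤ n → motive ((K.lefschetz ^ j) ω))
    (ha : ∀ ω ν, motive ω → motive ν → motive (ω + ν)) (ω : Ω) : motive ω := by
  obtain ⟨x, rfl⟩ := K.assemble_surjective ω
  induction x using DirectSum.induction_on with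
  | zero => simpa using hz
  | of i ω =>
    rw [← DirectSum.lof_eq_of ℂ, assemble_of]
    exact hb _ _ _ _ ω.2 i.2
  | add x y hx hy => rw [map_add]; exact ha _ _ hx hy

lemma hodgeCoeff_mul (a b j : ℕ) (hj : a + b + j ≤ n) :
    hodgeCoeff n a b j * hodgeCoeff n a b (n - j - (a + b)) = (-1) ^ (a + b) := by
  have e : n - (n - j - (a + b)) - (a + b) = j := by omega
  have hI : (Complex.I ^ ((a : ℤ) - (b : ℤ))) * (Complex.I ^ ((a : ℤ) - (b : ℤ))) =
      (-1) ^ (a + b) := by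
    have h1 : (-1 : ℂ) ^ b * (-1) ^ b = 1 := by rw [← mul_pow]; simp
    rw [← mul_zpow, Complex.I_mul_I, zpow_sub₀ (by norm_num), zpow_natCast, zpow_natCast,
      div_eq_iff (by simp), pow_add, mul_assoc, h1, mul_one]
  have hs : ((-1 : ℂ) ^ ((a + b) * (a + b + 1) / 2)) * (-1) ^ ((a + b) * (a + b + 1) / 2) = 1 := by
    rw [← mul_pow]; simp
  have f1 : (j.factorial : ℂ) ≠ 0 := by exact_mod_cast j.factorial_ne_zero
  have f2 : ((n - j - (a + b)).factorial : ℂ) ≠ 0 := by exact_mod_cast Nat.factorial_ne_zero _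
  simp only [hodgeCoeff, e]
  calc _ = (((-1 : ℂ) ^ ((a + b) * (a + b + 1) / 2)) * (-1) ^ ((a + b) * (a + b + 1) / 2)) *
        ((Complex.I ^ ((a : ℤ) - (b : ℤ))) * (Complex.I ^ ((a : ℤ) - (b : ℤ)))) *
        (((j.factorial : ℂ) / ((n - j - (a + b)).factorial : ℂ)) *
          (((n - j - (a + b)).factorial : ℂ) / (j.factorial : ℂ))) := by ring
    _ = _ := by rw [hs, hI]; field_simp

lemma hodge_hodge (ω : Ω) : K.hodge (K.hodge ω) = C.parity ω := by
  induction ω using K.lefschetz_induction with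
  | hz => simp
  | hb a b j ω h hj =>
    rw [K.hodge_apply h hj, map_smul, K.hodge_apply h (by omega), smul_smul,
      hodgeCoeff_mul a b j hj, C.parity_of_mem (K.bideg_le _ (K.lefschetz_pow_mem j h.1)),
      show n - (n - j - (a + b)) - (a + b) = j by omega]
    congr 1
    simp only
    rw [show a + j + (b + j) = (a + b) + 2 * j by ring, pow_add _ (a + b), pow_mul]; simp
  | ha ω ν h1 h2 => simp [h1, h2]

lemma hodge_bijective : Function.Bijective K.hodge := by
  constructor
  · intro x y h
    have := congrArg (fun z => C.parity (K.hodge z)) h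
    simpa only [hodge_hodge, C.parity_parity] using this
  · intro x
    exact ⟨K.hodge (C.parity x), by rw [hodge_hodge, C.parity_parity]⟩

/-- The Hodge map as a linear isomorphism. -/
def hodgeEquiv : Ω ≃ₗ[ℂ] Ω := LinearEquiv.ofBijective K.hodge K.hodge_bijective

/-- The dual Lefschetz operator `Λ = *⁻¹ ∘ L ∘ *`. -/
def dualLefschetz : Ω →ₗ[ℂ] Ω :=
  K.hodgeEquiv.symm.toLinearMap ∘ₗ K.lefschetz ∘ₗ K.hodgeEquiv.toLinearMap

/-- The `B`-valued metric on forms: distinct degrees are orthogonal, and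
`g(ω, ν) = *(ω ∧ *(ν^*))` for `ω`, `ν` of the same degree. -/
def metric (ω ν : Ω) : B :=
  ∑ k ∈ Finset.range (2 * n + 1),
    C.toBase (K.hodge (C.proj k ω * K.hodge (C.conj (C.proj k ν))))

lemma lefschetz_pow_mul_incl (m : ℕ) (ω : Ω) (b : B) :
    (K.lefschetz ^ m) (ω * C.incl b) = (K.lefschetz ^ m) ω * C.incl b := by
  simp [lefschetz_pow_apply, mul_assoc]

lemma lefschetz_pow_incl_mul (m : ℕ) (ω : Ω) (b : B) :
    (K.lefschetz ^ m) (C.incl b * ω) = C.incl b * (K.lefschetz ^ m) ω := by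
  simp only [lefschetz_pow_apply, ← mul_assoc]
  rw [(Commute.pow_left (K.κ_central (C.incl b)) m).eq]

lemma hodge_mul_incl (ω : Ω) (b : B) : K.hodge (ω * C.incl b) = K.hodge ω * C.incl b := by
  induction ω using K.lefschetz_induction with
  | hz => simp
  | hb a c j ω h hj =>
    have h' : ω * C.incl b ∈ K.primitive (a, c) :=
      ⟨K.mul_incl_mem h.1 b, by
        exact (K.lefschetz_pow_mul_incl _ ω b).trans (by rw [show (K.lefschetz ^ _) ω = 0 from h.2, zero_mul])⟩
    rw [← lefschetz_pow_mul_incl, K.hodge_apply h' hj, K.hodge_apply h hj,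
      lefschetz_pow_mul_incl, smul_mul_assoc]
  | ha ω ν h1 h2 => simp [add_mul, h1, h2]

lemma hodge_incl_mul (ω : Ω) (b : B) : K.hodge (C.incl b * ω) = C.incl b * K.hodge ω := by
  induction ω using K.lefschetz_induction with
  | hz => simp
  | hb a c j ω h hj =>
    have h' : C.incl b * ω ∈ K.primitive (a, c) :=
      ⟨K.incl_mul_mem h.1 b, by
        exact (K.lefschetz_pow_incl_mul _ ω b).trans (by rw [show (K.lefschetz ^ _) ω = 0 from h.2, mul_zero])⟩
    rw [← lefschetz_pow_incl_mul, K.hodge_apply h' hj, K.hodge_apply h hj,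
      lefschetz_pow_incl_mul, mul_smul_comm]
  | ha ω ν h1 h2 => simp [mul_add, h1, h2]

lemma lefschetz_mul_incl (ω : Ω) (b : B) :
    K.lefschetz (ω * C.incl b) = K.lefschetz ω * C.incl b := by
  simp [lefschetz, mul_assoc]

lemma dualLefschetz_mul_incl (ω : Ω) (b : B) :
    K.dualLefschetz (ω * C.incl b) = K.dualLefschetz ω * C.incl b := by
  apply K.hodge_bijective.1
  have e : ∀ ν, K.hodge (K.dualLefschetz ν) = K.lefschetz (K.hodge ν) := fun ν =>
    K.hodgeEquiv.apply_symm_apply _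
  rw [hodge_mul_incl, e, e, hodge_mul_incl, lefschetz_mul_incl]

lemma metric_balanced (ω ν : Ω) (b : B) :
    K.metric (ω * C.incl b) ν = K.metric ω (ν * C.incl (star b)) := by
  refine Finset.sum_congr rfl fun k _ => ?_
  rw [C.proj_mul_incl, C.proj_mul_incl, C.conj_mul_incl, star_star, hodge_incl_mul, mul_assoc]

/-- The metric as a map that is linear in the first and conjugate linear in the second variable. -/
def metricForm : Ω →ₗ[ℂ] Ω →ₛₗ[starRingEnd ℂ] B :=
  LinearMap.mk₂'ₛₗ (RingHom.id ℂ) (starRingEnd ℂ) K.metric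
    (fun ω ω' ν => by simp [metric, add_mul, Finset.sum_add_distrib])
    (fun c ω ν => by simp [metric, Finset.smul_sum])
    (fun ω ν ν' => by simp [metric, mul_add, Finset.sum_add_distrib])
    (fun c ω ν => by simp [metric, Finset.smul_sum])

end HermitianStructure

/-! ### Forms with values in a module -/

section TwistedForms

variable {B Ω : Type*} [Ring B] [Algebra ℂ B] [Ring Ω] [Algebra ℂ Ω]
  (C : DifferentialCalculus B Ω)
  (F : Type*) [AddCommGroup F] [Module B F] [Module ℂ F]

/-- The relations `ω b ⊗ f = ω ⊗ b f` defining the tensor product over `B`. -/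
def balancing : Submodule ℂ (Ω ⊗[ℂ] F) :=
  Submodule.span ℂ {x | ∃ (ω : Ω) (b : B) (f : F), x = (ω * C.incl b) ⊗ₜ f - ω ⊗ₜ (b • f)}

/-- The space `Ω ⊗_B F` of forms with values in the left `B`-module `F`. -/
abbrev TwistedForms : Type _ := (Ω ⊗[ℂ] F) ⧸ balancing C F

variable {F}

/-- The element `ω ⊗ f` of `Ω ⊗_B F`. -/
def tmulB (ω : Ω) (f : F) : TwistedForms C F := (balancing C F).mkQ (ω ⊗ₜ f)

lemma tmulB_smul (ω : Ω) (b : B) (f : F) : tmulB C (ω * C.incl b) f = tmulB C ω (b • f) := by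
  simp only [tmulB]
  rw [← sub_eq_zero, ← map_sub, Submodule.mkQ_apply, Submodule.Quotient.mk_eq_zero]
  exact Submodule.subset_span ⟨ω, b, f, rfl⟩

lemma TwistedForms.induction {motive : TwistedForms C F → Prop} (hz : motive 0)
    (ht : ∀ ω f, motive (tmulB C ω f)) (ha : ∀ α β, motive α → motive β → motive (α + β))
    (α : TwistedForms C F) : motive α := by
  obtain ⟨x, rfl⟩ := (balancing C F).mkQ_surjective α
  induction x using TensorProduct.induction_on with
  | zero => simpa using hz
  | tmul ω f => exact ht ω f
  | add x y hx hy => rw [map_add]; exact ha _ _ hx hy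

/-- The universal property of `Ω ⊗_B F`. -/
def liftB {σ : ℂ →+* ℂ} {X : Type*} [AddCommGroup X] [Module ℂ X] (T : Ω →ₛₗ[σ] F →ₛₗ[σ] X)
    (hT : ∀ ω b f, T (ω * C.incl b) f = T ω (b • f)) : TwistedForms C F →ₛₗ[σ] X :=
  (balancing C F).liftQ (TensorProduct.lift T) (by
    rw [balancing, Submodule.span_le]
    rintro _ ⟨ω, b, f, rfl⟩
    simp [hT])

@[simp] lemma liftB_tmulB {σ : ℂ →+* ℂ} {X : Type*} [AddCommGroup X] [Module ℂ X]
    (T : Ω →ₛₗ[σ] F →ₛₗ[σ] X) (hT : ∀ ω b f, T (ω * C.incl b) f = T ω (b • f)) (ω : Ω) (f : F) :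
    liftB C T hT (tmulB C ω f) = T ω f := rfl

lemma tmulB_add_left (ω ω' : Ω) (f : F) :
    tmulB C (ω + ω') f = tmulB C ω f + tmulB C ω' f := by
  simp [tmulB, TensorProduct.add_tmul]

lemma tmulB_add_right (ω : Ω) (f f' : F) :
    tmulB C ω (f + f') = tmulB C ω f + tmulB C ω f' := by
  simp [tmulB, TensorProduct.tmul_add]

lemma tmulB_smul_left (c : ℂ) (ω : Ω) (f : F) : tmulB C (c • ω) f = c • tmulB C ω f := by
  rw [tmulB, ← TensorProduct.smul_tmul', map_smul]; rfl

lemma tmulB_smul_right (c : ℂ) (ω : Ω) (f : F) : tmulB C ω (c • f) = c • tmulB C ω f := by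
  simp [tmulB]

variable (F) in
/-- The operator `T ⊗ id` on `Ω ⊗_B F`, for a right `B`-linear operator `T` on `Ω`. -/
def mapB (T : Ω →ₗ[ℂ] Ω) (hT : ∀ ω b, T (ω * C.incl b) = T ω * C.incl b) :
    TwistedForms C F →ₗ[ℂ] TwistedForms C F :=
  liftB C (LinearMap.mk₂ ℂ (fun ω f => tmulB C (T ω) f)
    (fun ω ω' f => by rw [map_add, tmulB_add_left])
    (fun c ω f => by rw [map_smul, tmulB_smul_left])
    (fun ω f f' => by rw [tmulB_add_right])
    (fun c ω f => by rw [tmulB_smul_right]))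
    (fun ω b f => by simp only [LinearMap.mk₂_apply]; rw [hT, tmulB_smul])

@[simp] lemma mapB_tmulB (T : Ω →ₗ[ℂ] Ω) (hT : ∀ ω b, T (ω * C.incl b) = T ω * C.incl b)
    (ω : Ω) (f : F) : mapB C F T hT (tmulB C ω f) = tmulB C (T ω) f := rfl

variable (F) in
/-- Left multiplication of `F`-valued forms by a form. -/
def wedge (ω : Ω) : TwistedForms C F →ₗ[ℂ] TwistedForms C F :=
  mapB C F (LinearMap.mulLeft ℂ ω) (fun ν b => by simp [mul_assoc])

@[simp] lemma wedge_tmulB (ω ν : Ω) (f : F) :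
    wedge C F ω (tmulB C ν f) = tmulB C (ω * ν) f := rfl

lemma wedge_wedge (ω ν : Ω) (α : TwistedForms C F) :
    wedge C F ω (wedge C F ν α) = wedge C F (ω * ν) α := by
  induction α using TwistedForms.induction with
  | hz => simp
  | ht => simp [mul_assoc]
  | ha α β h1 h2 => simp [h1, h2]

lemma wedge_add (ω ν : Ω) (α : TwistedForms C F) :
    wedge C F (ω + ν) α = wedge C F ω α + wedge C F ν α := by
  induction α using TwistedForms.induction with
  | hz => simp
  | ht => simp [add_mul, tmulB_add_left]
  | ha α β h1 h2 => simp only [map_add, h1, h2]; abel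

lemma wedge_smul (c : ℂ) (ω : Ω) (α : TwistedForms C F) :
    wedge C F (c • ω) α = c • wedge C F ω α := by
  induction α using TwistedForms.induction with
  | hz => simp
  | ht => simp [tmulB_smul_left]
  | ha α β h1 h2 => simp [h1, h2]

variable (F) in
/-- The image of `W ⊗ F` in `Ω ⊗_B F`, for a space of forms `W`. -/
def valuedIn (W : Submodule ℂ Ω) : Submodule ℂ (TwistedForms C F) :=
  Submodule.span ℂ {x | ∃ ω ∈ W, ∃ f : F, x = tmulB C ω f}

/-- The extension `δ(ω) ⊗ f + (-1)^|ω| ω ∧ ∇ f` to `Ω ⊗_B F` of a map `∇ : F → Ω ⊗_B F` which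
satisfies the Leibniz rule `∇(b f) = δ(b) ⊗ f + b ∇ f`. -/
def extend (δ : Ω →ₗ[ℂ] Ω)
    (hδ : ∀ ω b, δ (ω * C.incl b) = δ ω * C.incl b + C.parity ω * δ (C.incl b))
    (D : F →ₗ[ℂ] TwistedForms C F)
    (hD : ∀ b f, D (b • f) = tmulB C (δ (C.incl b)) f + wedge C F (C.incl b) (D f)) :
    TwistedForms C F →ₗ[ℂ] TwistedForms C F :=
  liftB C (LinearMap.mk₂ ℂ (fun ω f => tmulB C (δ ω) f + wedge C F (C.parity ω) (D f))
    (fun ω ω' f => by rw [map_add, map_add, tmulB_add_left, wedge_add]; abel)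
    (fun c ω f => by rw [map_smul, map_smul, tmulB_smul_left, wedge_smul, smul_add])
    (fun ω f f' => by rw [map_add, map_add, tmulB_add_right]; abel)
    (fun c ω f => by rw [map_smul, map_smul, tmulB_smul_right, smul_add]))
    (fun ω b f => by
      simp only [LinearMap.mk₂_apply]
      rw [hδ, C.parity_mul_incl, tmulB_add_left, tmulB_smul, hD, map_add, wedge_tmulB, wedge_wedge]
      abel)

end TwistedForms

/-! ### Hermitian and holomorphic modules -/

section Modules

variable {B Ω : Type*} [Ring B] [StarRing B] [Algebra ℂ B] [StarModule ℂ B]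
  [Ring Ω] [Algebra ℂ Ω]

/-- The non-zero elements of the cone of finite sums `∑ bᵢ^* bᵢ`; positive real coefficients
are absorbed into the `bᵢ`. -/
def IsPositiveElement (b : B) : Prop :=
  b ∈ AddSubmonoid.closure (Set.range fun c : B => star c * c) ∧ b ≠ 0

variable (B) in
/-- A Hermitian module: a finitely generated projective left `B`-module `F` together with an
isomorphism `k ↦ h(·, k)` of right `B`-modules from the conjugate module of `F` to the dual module
`Hom_B(F, B)`, such that `h(f, k) = h(k, f)^*`, and such that `h(f, f)` is a non-zero positive
element for all `f ≠ 0`. -/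
structure HermitianModule (F : Type*) [AddCommGroup F] [Module B F] where
  finite : Module.Finite B F
  projective : Module.Projective B F
  toDual : F → (F →ₗ[B] B)
  toDual_add : ∀ k k', toDual (k + k') = toDual k + toDual k'
  toDual_smul : ∀ (b : B) k f, toDual (b • k) f = toDual k f * star b
  toDual_bijective : Function.Bijective toDual
  symm : ∀ f k, toDual k f = star (toDual f k)
  pos : ∀ f, f ≠ 0 → IsPositiveElement (toDual f f)

/-- The sesquilinear pairing `h(f, k)`. -/
def HermitianModule.pairing {F : Type*} [AddCommGroup F] [Module B F] (H : HermitianModule B F)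
    (f k : F) : B := H.toDual k f

variable {C : DifferentialStarCalculus B Ω}

/-- The extension to `Ω ⊗_B F` of a map `D : F → Ω ⊗_B F` satisfying the Leibniz rule with respect
to `∂̄`. -/
def ComplexStructure.extendDelbar (K : ComplexStructure C) {F : Type*} [AddCommGroup F]
    [Module B F] [Module ℂ F]
    (D : F →ₗ[ℂ] TwistedForms C.toDifferentialCalculus F)
    (hD : ∀ (b : B) f, D (b • f) =
      tmulB C.toDifferentialCalculus (K.delbar (C.incl b)) f +
        wedge C.toDifferentialCalculus F (C.incl b) (D f)) :
    Module.End ℂ (TwistedForms C.toDifferentialCalculus F) :=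
  extend C.toDifferentialCalculus K.delbar (fun ω b => (K.del_delbar_mul_incl ω b).2) D hD

/-- A holomorphic module: a finitely generated projective left `B`-module together with a flat
`(0, 1)`-connection. -/
structure HolomorphicModule (K : ComplexStructure C) (F : Type*) [AddCommGroup F] [Module B F]
    [Module ℂ F] where
  finite : Module.Finite B F
  projective : Module.Projective B F
  delbar : F →ₗ[ℂ] TwistedForms C.toDifferentialCalculus F
  delbar_mem : ∀ f, delbar f ∈ valuedIn C.toDifferentialCalculus F (K.bideg (0, 1))
  delbar_smul : ∀ (b : B) f, delbar (b • f) =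
    tmulB C.toDifferentialCalculus (K.delbar (C.incl b)) f +
      wedge C.toDifferentialCalculus F (C.incl b) (delbar f)
  flat : ∀ f, K.extendDelbar delbar delbar_smul (delbar f) = 0

/-- A Hermitian holomorphic module. -/
structure HermitianHolomorphicModule (K : ComplexStructure C) (F : Type*) [AddCommGroup F]
    [Module B F] [Module ℂ F] extends HermitianModule B F, HolomorphicModule K F

namespace HermitianModule

variable {F : Type*} [AddCommGroup F] [Module B F] [Module ℂ F] [IsScalarTower ℂ B F]
  (H : HermitianModule B F)

set_option linter.unusedSectionVars false

lemma pairing_add_left (f f' k : F) : H.pairing (f + f') k = H.pairing f k + H.pairing f' k :=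
  map_add _ _ _

lemma pairing_add_right (f k k' : F) : H.pairing f (k + k') = H.pairing f k + H.pairing f k' := by
  simp [pairing, H.toDual_add]

lemma pairing_smul_left (b : B) (f k : F) : H.pairing (b • f) k = b * H.pairing f k :=
  map_smul _ _ _

lemma pairing_smul_right (b : B) (f k : F) : H.pairing f (b • k) = H.pairing f k * star b :=
  H.toDual_smul b k f

lemma pairing_smul_left' (c : ℂ) (f k : F) : H.pairing (c • f) k = c • H.pairing f k := by
  rw [← one_smul B f, ← smul_assoc, pairing_smul_left, smul_mul_assoc, one_mul, one_smul]

lemma pairing_smul_right' (c : ℂ) (f k : F) :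
    H.pairing f (c • k) = (starRingEnd ℂ c) • H.pairing f k := by
  rw [← one_smul B k, ← smul_assoc, pairing_smul_right, star_smul, mul_smul_comm, star_one,
    mul_one, one_smul]
  rfl

/-- The map `(Ω ⊗_B F) × (Ω ⊗_B F) → X` given by `(ω ⊗ f, ν ⊗ k) ↦ S (ω h(f, k)) ν`, for `S` linear
in the first variable, conjugate linear in the second, and satisfying `S (ω b) ν = S ω (ν b^*)`. -/
def twist {X : Type*} [AddCommGroup X] [Module ℂ X] (S : Ω →ₗ[ℂ] Ω →ₛₗ[starRingEnd ℂ] X)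
    (hS : ∀ ω ν b, S (ω * C.incl b) ν = S ω (ν * C.incl (star b))) :
    TwistedForms C.toDifferentialCalculus F →ₗ[ℂ]
      TwistedForms C.toDifferentialCalculus F →ₛₗ[starRingEnd ℂ] X :=
  liftB C.toDifferentialCalculus (LinearMap.mk₂ ℂ
    (fun ω f => liftB C.toDifferentialCalculus
      (LinearMap.mk₂'ₛₗ (starRingEnd ℂ) (starRingEnd ℂ)
        (fun ν k => S (ω * C.incl (H.pairing f k)) ν)
        (fun ν ν' k => map_add _ _ _)
        (fun c ν k => map_smulₛₗ _ _ _)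
        (fun ν k k' => by rw [pairing_add_right, map_add, mul_add, map_add]; rfl)
        (fun c ν k => by
          rw [pairing_smul_right', map_smul, mul_smul_comm, map_smul]; rfl))
      (fun ν b k => by
        simp only [LinearMap.mk₂'ₛₗ_apply]
        rw [pairing_smul_right, map_mul C.incl, ← mul_assoc, hS _ ν, star_star]))
    (fun ω ω' f => by
      refine LinearMap.ext fun α => ?_
      induction α using TwistedForms.induction with
      | hz => simp
      | ht ν k => simp [add_mul]
      | ha α β h1 h2 => rw [map_add, map_add, h1, h2])
    (fun c ω f => by
      refine LinearMap.ext fun α => ?_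
      induction α using TwistedForms.induction with
      | hz => simp
      | ht ν k => simp
      | ha α β h1 h2 => rw [map_add, map_add, h1, h2])
    (fun ω f f' => by
      refine LinearMap.ext fun α => ?_
      induction α using TwistedForms.induction with
      | hz => simp
      | ht ν k => simp [pairing_add_left, mul_add]
      | ha α β h1 h2 => rw [map_add, map_add, h1, h2])
    (fun c ω f => by
      refine LinearMap.ext fun α => ?_
      induction α using TwistedForms.induction with
      | hz => simp
      | ht ν k => simp [pairing_smul_left']
      | ha α β h1 h2 => rw [map_add, map_add, h1, h2]))
    (fun ω b f => by
      refine LinearMap.ext fun α => ?_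
      simp only [LinearMap.mk₂_apply]
      induction α using TwistedForms.induction with
      | hz => simp
      | ht ν k => simp [pairing_smul_left, mul_assoc]
      | ha α β h1 h2 => rw [map_add, map_add, h1, h2])

lemma twist_tmulB {X : Type*} [AddCommGroup X] [Module ℂ X]
    (S : Ω →ₗ[ℂ] Ω →ₛₗ[starRingEnd ℂ] X)
    (hS : ∀ ω ν b, S (ω * C.incl b) ν = S ω (ν * C.incl (star b))) (ω ν : Ω) (f k : F) :
    H.twist S hS (tmulB C.toDifferentialCalculus ω f) (tmulB C.toDifferentialCalculus ν k) =
      S (ω * C.incl (H.pairing f k)) ν := rfl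

variable (C) in
/-- The extension of `h` to forms: `h(ω ⊗ f, ν ⊗ k) = ω h(f, k) ∧ ν^*`. -/
def formPairing : TwistedForms C.toDifferentialCalculus F →ₗ[ℂ]
    TwistedForms C.toDifferentialCalculus F →ₛₗ[starRingEnd ℂ] Ω :=
  H.twist (C := C) (LinearMap.mk₂'ₛₗ (RingHom.id ℂ) (starRingEnd ℂ) (fun ω ν => ω * C.conj ν)
      (fun ω ω' ν => add_mul _ _ _)
      (fun c ω ν => smul_mul_assoc _ _ _)
      (fun ω ν ν' => by rw [map_add, mul_add])
      (fun c ω ν => by rw [map_smulₛₗ, mul_smul_comm]))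
    (fun ω ν b => by simp [C.conj_mul_incl, mul_assoc])

/-- The Hermitian metric `g(ω ⊗ f, ν ⊗ k) = g(ω h(f, k), ν)` on `Ω ⊗_B F`. -/
def twistedMetric {n : ℕ} (K : HermitianStructure C n) :
    TwistedForms C.toDifferentialCalculus F →ₗ[ℂ]
      TwistedForms C.toDifferentialCalculus F →ₛₗ[starRingEnd ℂ] B :=
  H.twist (C := C) K.metricForm K.metric_balanced

end HermitianModule

/-! ### States, integrals and inner products -/

variable (B) in
/-- A state: a linear functional with `φ(b^* b) > 0` for all non-zero `b`. -/
structure State where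
  toLinearMap : B →ₗ[ℂ] ℂ
  pos : ∀ b : B, b ≠ 0 →
    0 < (toLinearMap (star b * b)).re ∧ (toLinearMap (star b * b)).im = 0

/-- The integral `φ ∘ *` on forms of top degree. -/
def HermitianStructure.integral {n : ℕ} (K : HermitianStructure C n) (φ : State B) : Ω →ₗ[ℂ] ℂ :=
  φ.toLinearMap ∘ₗ C.toBase ∘ₗ K.hodge

/-- The integral is closed if it vanishes on exact forms of top degree. -/
def HermitianStructure.IntegralClosed {n : ℕ} (K : HermitianStructure C n) (φ : State B) : Prop :=
  ∀ k, k + 1 = 2 * n → ∀ ω ∈ C.deg k, K.integral φ (C.d ω) = 0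

/-- The pairing `⟨α, β⟩ = φ(g(α, β))` on `Ω ⊗_B F`. -/
def HermitianModule.inner {F : Type*} [AddCommGroup F] [Module B F] [Module ℂ F]
    [IsScalarTower ℂ B F] (H : HermitianModule B F) {n : ℕ} (K : HermitianStructure C n)
    (φ : State B) (α β : TwistedForms C.toDifferentialCalculus F) : ℂ :=
  φ.toLinearMap (H.twistedMetric K α β)

/-- `T'` is an adjoint of `T` with respect to the pairing `s`. -/
def IsAdjoint {V : Type*} [AddCommGroup V] [Module ℂ V] (s : V → V → ℂ) (T T' : Module.End ℂ V) :
    Prop := ∀ α β, s (T α) β = s α (T' β)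

/-! ### Twisted Lefschetz operators and the Chern connection -/

variable (F : Type*) [AddCommGroup F] [Module B F] [Module ℂ F]

/-- The operator `Λ ⊗ id` on `Ω ⊗_B F`. -/
def HermitianStructure.twistedDualLefschetz {n : ℕ} (K : HermitianStructure C n) :
    Module.End ℂ (TwistedForms C.toDifferentialCalculus F) :=
  mapB C.toDifferentialCalculus F K.dualLefschetz K.dualLefschetz_mul_incl

/-- The operator `proj ⊗ id` on `Ω ⊗_B F`, for `proj` the projection onto bidegree `p`. -/
def ComplexStructure.twistedBiproj (K : ComplexStructure C) (p : ℕ × ℕ) :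
    Module.End ℂ (TwistedForms C.toDifferentialCalculus F) :=
  mapB C.toDifferentialCalculus F (K.biproj p) (K.biproj_mul_incl p)

variable {F}

/-- `D : F → Ω^1 ⊗_B F` is a left connection. -/
structure IsConnection (C : DifferentialCalculus B Ω) (D : F →ₗ[ℂ] TwistedForms C F) : Prop where
  mem : ∀ f, D f ∈ valuedIn C F (C.deg 1)
  leibniz : ∀ (b : B) f, D (b • f) = tmulB C (C.d (C.incl b)) f + wedge C F (C.incl b) (D f)

/-- The extension `∇(ω ⊗ f) = dω ⊗ f + (-1)^|ω| ω ∧ ∇ f` of a connection to `Ω ⊗_B F`. -/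
def IsConnection.extension {C : DifferentialCalculus B Ω} {D : F →ₗ[ℂ] TwistedForms C F}
    (h : IsConnection C D) : Module.End ℂ (TwistedForms C F) :=
  extend C C.d C.d_mul_incl D h.leibniz

/-- `D` is a Chern connection: a Hermitian connection whose `(0, 1)`-part is the holomorphic
structure of the module. -/
structure HermitianHolomorphicModule.IsChernConnection [IsScalarTower ℂ B F]
    {K : ComplexStructure C} (E : HermitianHolomorphicModule K F)
    (D : F →ₗ[ℂ] TwistedForms C.toDifferentialCalculus F) : Prop
    extends IsConnection C.toDifferentialCalculus D where
  hermitian : ∀ f k : F, C.d (C.incl (E.pairing f k)) =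
    E.formPairing C (D f) (tmulB C.toDifferentialCalculus 1 k) +
      E.formPairing C (tmulB C.toDifferentialCalculus 1 f) (D k)
  proj_eq : ∀ f, K.twistedBiproj F (0, 1) (D f) = E.delbar f

lemma ComplexStructure.twistedBiproj_wedge (K : ComplexStructure C) (p : ℕ × ℕ) (b : B)
    (α : TwistedForms C.toDifferentialCalculus F) :
    K.twistedBiproj F p (wedge C.toDifferentialCalculus F (C.incl b) α) =
      wedge C.toDifferentialCalculus F (C.incl b) (K.twistedBiproj F p α) := by
  induction α using TwistedForms.induction with
  | hz => simp
  | ht ω f => simp [twistedBiproj, K.biproj_incl_mul]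
  | ha α β h1 h2 => simp only [map_add, h1, h2]

/-- The operator `∂_F` on `Ω ⊗_B F`: the extension of the `(1, 0)`-part of the connection. -/
def IsConnection.delExtension {D : F →ₗ[ℂ] TwistedForms C.toDifferentialCalculus F}
    (h : IsConnection C.toDifferentialCalculus D) (K : ComplexStructure C) :
    Module.End ℂ (TwistedForms C.toDifferentialCalculus F) :=
  extend C.toDifferentialCalculus K.del (fun ω b => (K.del_delbar_mul_incl ω b).1)
    (K.twistedBiproj F (1, 0) ∘ₗ D) (fun b f => by
      rw [LinearMap.comp_apply, h.leibniz, map_add, K.twistedBiproj_wedge, LinearMap.comp_apply]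
      congr 1
      rw [ComplexStructure.twistedBiproj, mapB_tmulB, K.biproj_one_zero_d_incl])

/-- The Chern connection `∇`, extended to `Ω ⊗_B F`. -/
abbrev HermitianHolomorphicModule.IsChernConnection.nabla [IsScalarTower ℂ B F]
    {K : ComplexStructure C} {E : HermitianHolomorphicModule K F}
    {D : F →ₗ[ℂ] TwistedForms C.toDifferentialCalculus F} (h : E.IsChernConnection D) :
    Module.End ℂ (TwistedForms C.toDifferentialCalculus F) :=
  h.toIsConnection.extension

/-- The `(1, 0)`-part `∂_F` of the Chern connection, extended to `Ω ⊗_B F`. -/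
abbrev HermitianHolomorphicModule.IsChernConnection.del [IsScalarTower ℂ B F]
    {K : ComplexStructure C} {E : HermitianHolomorphicModule K F}
    {D : F →ₗ[ℂ] TwistedForms C.toDifferentialCalculus F} (h : E.IsChernConnection D) :
    Module.End ℂ (TwistedForms C.toDifferentialCalculus F) :=
  h.toIsConnection.delExtension K

/-- The operator `∂̄_F` on `Ω ⊗_B F`: the extension of the holomorphic structure. -/
def HolomorphicModule.delbarExtension {K : ComplexStructure C} (E : HolomorphicModule K F) :
    Module.End ℂ (TwistedForms C.toDifferentialCalculus F) :=
  K.extendDelbar E.delbar E.delbar_smul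

end Modules

end NCGeom

end

/-! On a Kähler structure, the adjoint of each half of the Chern connection is, up to a factor ±i,
the commutator of `Λ` with the other half: ∂_F† = i[Λ, ∂̄_F] and ∂̄_F† = -i[Λ, ∂_F]. Given these and
∂_F² = ∂̄_F² = 0, all three formulas for the Laplacians are identities in an associative algebra
(`laplacian_identities`). The mixed anticommutator of ∂_F with ∂̄_F† is a multiple of [Λ, ∂_F²] = 0,
and likewise for the other one; since ∇² = ∂_F ∂̄_F + ∂̄_F ∂_F, the two Laplacians differ by [Λ,
i∇²].

The commutator formulas arise in two stages. First, ⟨α, β⟩ = ∫ h(α, *β)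
(`HermitianModule.inner_eq`), so integrating the Leibniz rule for h gives ∂_F† = -* ∂̄_F * and ∂̄_F†
= -* ∂_F * (`isAdjoint_extend`); the halves are exchanged because h is conjugate linear in its
second variable. Second, [Λ, ∂̄_F] = i * ∂̄_F *, and the conjugate identity holds for ∂_F.

The second stage rests on `dualLefschetz_commutator_of_zero_one`: [Λ, T] = i * T * for every linear
T of bidegree (0, 1) commuting with `L`, derivation or not. It therefore applies both to ∂̄ and to ω
↦ (-1)^|ω| ω ∧ η with η of type (0, 1), and these are the two constituents of ∂̄_F on Ω ⊗_B F
(`mapB_extend_commutator`).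

The Chern connection is governed by its (1, 0)-part, which the Hermitian condition prescribes
through h(∂_F f, k) = ∂h(f, k) - h(f, ∂̄_F k). A dual basis of the projective module shows that
these pairings determine ∂_F f and that some ∂_F realises them. Applying ∂² = 0 to h(f, k) transfers
flatness from ∂̄_F to ∂_F (`formPairing_extend_eq_zero`). -/

noncomputable section

namespace NCGeom

/-! ### Parity and odd differentials. -/

namespace DifferentialCalculus

variable {B Ω : Type*} [Ring B] [Algebra ℂ B] [Ring Ω] [Algebra ℂ Ω]
  (C : DifferentialCalculus B Ω)

lemma parity_mul (ω ν : Ω) : C.parity (ω * ν) = C.parity ω * C.parity ν := by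
  induction ω using C.induction with
  | hz => simp
  | ha ω ω' h1 h2 => simp only [add_mul, map_add, h1, h2]
  | hb k ω h =>
    induction ν using C.induction with
    | hz => simp
    | ha ν ν' h1 h2 => simp only [mul_add, map_add, h1, h2]
    | hb l ν h' =>
      rw [C.parity_of_mem h, C.parity_of_mem h', C.parity_of_mem (SetLike.GradedMul.mul_mem h h'),
        smul_mul_smul_comm, pow_add]

lemma parity_incl (b : B) : C.parity (C.incl b) = C.incl b := by
  rw [C.parity_of_mem (C.incl_mem b)]; simp

lemma parity_one : C.parity 1 = 1 := by
  simpa using C.parity_incl 1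

lemma toBase_eq_zero {k : ℕ} (hk : k ≠ 0) {ω : Ω} (h : ω ∈ C.deg k) : C.toBase ω = 0 := by
  have e : C.proj 0 ω = 0 := C.proj_ne h hk
  simp only [toBase, LinearMap.comp_apply, LinearEquiv.coe_coe]
  rw [LinearEquiv.symm_apply_eq, map_zero]
  exact Subtype.ext e

/-- An odd derivation of degree one of the algebra of forms which squares to zero. -/
structure IsDifferential (δ : Ω →ₗ[ℂ] Ω) : Prop where
  mem : ∀ k, ∀ ω ∈ C.deg k, δ ω ∈ C.deg (k + 1)
  map_mul : ∀ ω ν, δ (ω * ν) = δ ω * ν + C.parity ω * δ ν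
  sq : ∀ ω, δ (δ ω) = 0

variable {C} in
lemma IsDifferential.parity {δ : Ω →ₗ[ℂ] Ω} (h : C.IsDifferential δ) (ω : Ω) :
    C.parity (δ ω) = -δ (C.parity ω) := by
  induction ω using C.induction with
  | hz => simp
  | ha ω ν h1 h2 => simp only [map_add, h1, h2, neg_add]
  | hb k ω hω => rw [C.parity_of_mem hω, C.parity_of_mem (h.mem k ω hω), map_smul, pow_succ]; simp

variable {C} in
lemma IsDifferential.map_one {δ : Ω →ₗ[ℂ] Ω} (h : C.IsDifferential δ) : δ 1 = 0 := by
  have := h.map_mul 1 1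
  rw [C.parity_one] at this
  simpa using this

end DifferentialCalculus

/-! ### ∂ and ∂̄ as differentials exchanged by conjugation. -/

namespace ComplexStructure

variable {B Ω : Type*} [Ring B] [StarRing B] [Algebra ℂ B] [StarModule ℂ B]
  [Ring Ω] [Algebra ℂ Ω] {C : DifferentialStarCalculus B Ω} (K : ComplexStructure C)

lemma parity_of_mem {p : ℕ × ℕ} {ω : Ω} (h : ω ∈ K.bideg p) :
    C.parity ω = (-1 : ℂ) ^ (p.1 + p.2) • ω :=
  C.toDifferentialCalculus.parity_of_mem (K.bideg_le _ h)

lemma parity_mem {p : ℕ × ℕ} {ω : Ω} (h : ω ∈ K.bideg p) : C.parity ω ∈ K.bideg p := by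
  rw [K.parity_of_mem h]; exact Submodule.smul_mem _ _ h

lemma d_mul (ω ν : Ω) : C.d (ω * ν) = C.d ω * ν + C.parity ω * C.d ν := by
  induction ω using C.induction with
  | hz => simp
  | ha ω ω' h1 h2 => simp only [add_mul, map_add, h1, h2]; abel
  | hb k ω h => rw [C.d_mul k ω h, C.parity_of_mem h, smul_mul_assoc]

/-- On bihomogeneous forms these are the two bidegree components of the Leibniz rule for d. -/
lemma del_delbar_mul (ω ν : Ω) :
    K.del (ω * ν) = K.del ω * ν + C.parity ω * K.del ν ∧
    K.delbar (ω * ν) = K.delbar ω * ν + C.parity ω * K.delbar ν := by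
  induction ω using K.induction with
  | hz => simp
  | ha ω ω' h1 h2 =>
    simp only [add_mul, map_add, h1.1, h1.2, h2.1, h2.2]
    constructor <;> abel
  | hb p ω h =>
    induction ν using K.induction with
    | hz => simp
    | ha ν ν' h1 h2 =>
      simp only [mul_add, map_add, h1.1, h1.2, h2.1, h2.2]
      constructor <;> abel
    | hb q ν h' =>
      obtain ⟨a, b⟩ := p
      obtain ⟨a', b'⟩ := q
      have e := d_mul (C := C) ω ν
      have hm := K.mul_mem h h'
      have hP := K.parity_mem h
      refine K.separate (p := (a + a' + 1, b + b')) (q := (a + a', b + b' + 1)) (by simp)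
        (K.del_mem _ _ _ hm) ?_ (K.delbar_mem _ _ _ hm) ?_ ?_
      · refine add_mem ?_ ?_
        · convert K.mul_mem (K.del_mem _ _ _ h) h' using 2
          simp only [Prod.mk_add_mk]; congr 1; omega
        · exact K.mul_mem hP (K.del_mem _ _ _ h')
      · refine add_mem ?_ ?_
        · convert K.mul_mem (K.delbar_mem _ _ _ h) h' using 2
          simp only [Prod.mk_add_mk]; congr 1; omega
        · exact K.mul_mem hP (K.delbar_mem _ _ _ h')
      · rw [K.d_eq] at e
        simp only [LinearMap.add_apply, add_mul, mul_add] at e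
        rw [e]; abel

/-- For ω of bidegree (a, b), ∂²ω and ∂̄²ω are the only parts of d²ω = 0 in bidegrees (a + 2, b) and
(a, b + 2). -/
lemma del_delbar_sq (ω : Ω) : K.del (K.del ω) = 0 ∧ K.delbar (K.delbar ω) = 0 := by
  induction ω using K.induction with
  | hz => simp
  | ha ω ν h1 h2 => simp [h1, h2]
  | hb p ω h =>
    obtain ⟨a, b⟩ := p
    have e := C.d_d ω
    simp only [K.d_eq, LinearMap.add_apply, map_add] at e
    have m1 := K.del_mem _ _ _ (K.del_mem _ _ _ h)
    have m2 := K.del_mem _ _ _ (K.delbar_mem _ _ _ h)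
    have m3 := K.delbar_mem _ _ _ (K.del_mem _ _ _ h)
    have m4 := K.delbar_mem _ _ _ (K.delbar_mem _ _ _ h)
    constructor
    · have := congrArg (K.biproj (a + 1 + 1, b)) e
      simpa [K.biproj_same m1, K.biproj_ne m2 (q := (a + 1 + 1, b)),
        K.biproj_ne m3 (q := (a + 1 + 1, b)),
        K.biproj_ne m4 (q := (a + 1 + 1, b))
          (fun h => by simp [Prod.ext_iff] at h; omega)] using this
    · have := congrArg (K.biproj (a, b + 1 + 1)) e
      simpa [K.biproj_same m4, K.biproj_ne m2 (q := (a, b + 1 + 1)),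
        K.biproj_ne m3 (q := (a, b + 1 + 1)),
        K.biproj_ne m1 (q := (a, b + 1 + 1))
          (fun h => by simp [Prod.ext_iff] at h; omega)] using this

lemma isDifferential_del : C.IsDifferential K.del where
  mem k ω h := by
    have hle : C.deg k ≤ (C.deg (k + 1)).comap K.del := by
      rw [K.deg_eq k]
      refine iSup₂_le fun p hp ν hν => ?_
      have := K.bideg_le _ (K.del_mem _ _ _ hν)
      rwa [show (p.1 + 1, p.2).1 + (p.1 + 1, p.2).2 = k + 1 by simp only; omega] at this
    exact hle h
  map_mul ω ν := (K.del_delbar_mul ω ν).1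
  sq ω := (K.del_delbar_sq ω).1

lemma isDifferential_delbar : C.IsDifferential K.delbar where
  mem k ω h := by
    have hle : C.deg k ≤ (C.deg (k + 1)).comap K.delbar := by
      rw [K.deg_eq k]
      refine iSup₂_le fun p hp ν hν => ?_
      have := K.bideg_le _ (K.delbar_mem _ _ _ hν)
      rwa [show (p.1, p.2 + 1).1 + (p.1, p.2 + 1).2 = k + 1 by simp only; omega] at this
    exact hle h
  map_mul ω ν := (K.del_delbar_mul ω ν).2
  sq ω := (K.del_delbar_sq ω).2

/-- Conjugation commutes with d and swaps the two entries of a bidegree, so comparing components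
exchanges ∂ and ∂̄. -/
lemma conj_del_delbar (ω : Ω) :
    C.conj (K.del ω) = K.delbar (C.conj ω) ∧ C.conj (K.delbar ω) = K.del (C.conj ω) := by
  induction ω using K.induction with
  | hz => simp
  | ha ω ν h1 h2 => simp [h1, h2]
  | hb p ω h =>
    obtain ⟨a, b⟩ := p
    have hc := (K.conj_mem a b ω).2 h
    have e := C.conj_d ω
    simp only [K.d_eq, LinearMap.add_apply, map_add] at e
    refine K.separate (p := (b, a + 1)) (q := (b + 1, a)) (by simp)
      ((K.conj_mem _ _ _).2 (K.del_mem _ _ _ h)) (K.delbar_mem _ _ _ hc)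
      ((K.conj_mem _ _ _).2 (K.delbar_mem _ _ _ h)) (K.del_mem _ _ _ hc) ?_
    rw [e, add_comm]

lemma conj_mem_swap {p : ℕ × ℕ} {ω : Ω} (h : ω ∈ K.bideg p) : C.conj ω ∈ K.bideg p.swap :=
  (K.conj_mem p.1 p.2 ω).2 h

end ComplexStructure

/-! ### Conjugation, the Hodge map and the metric. -/

namespace HermitianStructure

variable {B Ω : Type*} [Ring B] [StarRing B] [Algebra ℂ B] [StarModule ℂ B]
  [Ring Ω] [Algebra ℂ Ω] {C : DifferentialStarCalculus B Ω} {n : ℕ}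
  (K : HermitianStructure C n)

lemma parity_kappa : C.parity K.κ = K.κ := by
  rw [K.parity_of_mem K.κ_mem]; simp

lemma conj_kappa_mul (ω : Ω) : C.conj (K.κ * ω) = K.κ * C.conj ω := by
  induction ω using K.toComplexStructure.induction with
  | hz => simp
  | ha ω ν h1 h2 => simp only [mul_add, map_add, h1, h2]
  | hb p ω h =>
    rw [C.conj_mul _ _ _ (K.bideg_le _ K.κ_mem) _ (K.bideg_le _ h), K.κ_real, ← K.κ_central]
    simp [pow_mul]

lemma conj_lefschetz_pow (m : ℕ) (ω : Ω) :
    C.conj ((K.lefschetz ^ m) ω) = (K.lefschetz ^ m) (C.conj ω) := by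
  induction m with
  | zero => simp
  | succ m ih =>
    rw [pow_succ', Module.End.mul_apply, Module.End.mul_apply, ← ih]
    exact K.conj_kappa_mul _

lemma conj_primitive {a b : ℕ} {ω : Ω} (h : ω ∈ K.primitive (a, b)) :
    C.conj ω ∈ K.primitive (b, a) := by
  refine ⟨(K.conj_mem _ _ _).2 h.1, ?_⟩
  have h0 : (K.lefschetz ^ (n + 1 - (a + b))) ω = 0 := h.2
  change (K.lefschetz ^ (n + 1 - (b + a))) _ = 0
  rw [← K.conj_lefschetz_pow, add_comm b a, h0, map_zero]

lemma star_hodgeCoeff (a b j : ℕ) :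
    (starRingEnd ℂ) (hodgeCoeff n a b j) = hodgeCoeff n b a j := by
  simp only [hodgeCoeff, map_mul, map_pow, map_neg, map_one, map_zpow₀, Complex.conj_I, map_div₀,
    map_natCast, add_comm b a]
  congr 2
  rw [← Complex.inv_I, inv_zpow', neg_sub]

/-- Conjugation commutes with `L`, maps primitive forms of type (a, b) to type (b, a), and the Weil
coefficients of the two types are complex conjugates. This reality of the Hodge map makes [Λ, ∂] the
conjugate of [Λ, ∂̄]. -/
lemma hodge_conj (ω : Ω) : K.hodge (C.conj ω) = C.conj (K.hodge ω) := by
  induction ω using K.lefschetz_induction with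
  | hz => simp
  | ha ω ν h1 h2 => simp only [map_add, h1, h2]
  | hb a b j ω h hj =>
    rw [K.conj_lefschetz_pow, K.hodge_apply h hj, K.hodge_apply (K.conj_primitive h) (by omega),
      map_smulₛₗ, K.conj_lefschetz_pow, star_hodgeCoeff, add_comm b a]

lemma hodge_dualLefschetz (ω : Ω) : K.hodge (K.dualLefschetz ω) = K.κ * K.hodge ω :=
  K.hodgeEquiv.apply_symm_apply _

lemma conj_dualLefschetz (ω : Ω) : K.dualLefschetz (C.conj ω) = C.conj (K.dualLefschetz ω) := by
  apply K.hodge_bijective.1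
  rw [hodge_dualLefschetz, hodge_conj, hodge_conj, hodge_dualLefschetz, conj_kappa_mul]

/-- The composition of the Hodge map with the projection to `B` vanishes off bidegree `(n, n)`. -/
lemma toBase_hodge_eq_zero {p : ℕ × ℕ} (hp : p ≠ (n, n)) {ω : Ω} (h : ω ∈ K.bideg p) :
    C.toBase (K.hodge ω) = 0 := by
  -- The claim is rephrased for arbitrary forms because the induction on the Lefschetz decomposition
  -- does not preserve membership in a fixed bidegree.
  suffices H : ∀ ν, C.toBase (K.hodge ν) = C.toBase (K.hodge (K.biproj (n, n) ν)) by
    rw [H, K.biproj_ne h hp, map_zero, map_zero]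
  intro ν
  induction ν using K.lefschetz_induction with
  | hz => simp
  | ha ω ν h1 h2 => simp only [map_add, h1, h2]
  | hb a b j ν h hj =>
    have hm := K.lefschetz_pow_mem j h.1
    by_cases hq : (a + j, b + j) = (n, n)
    · rw [K.biproj_same (by rwa [← hq])]
    -- The image under the Hodge map has degree a + b + 2(n - j - (a + b)), which is zero only if a
    -- = b = 0 and j = n, that is, in bidegree (n, n).
    · rw [K.biproj_ne hm hq, map_zero, map_zero, K.hodge_apply h hj, map_smul]
      rw [C.toBase_eq_zero _ (K.bideg_le _ (K.lefschetz_pow_mem _ h.1)), smul_zero]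
      simp only [Prod.mk.injEq, not_and] at hq
      simp only
      omega

lemma toBase_hodge_mul_eq_zero {p q : ℕ × ℕ} (hpq : p + q.swap ≠ (n, n)) {ω ν : Ω}
    (h : ω ∈ K.bideg p) (h' : ν ∈ K.bideg q) : C.toBase (K.hodge (ω * C.conj ν)) = 0 :=
  K.toBase_hodge_eq_zero hpq (K.mul_mem h (K.conj_mem_swap h'))

/-- Only products of total degree 2n contribute; there the degrees of the two factors have the same
parity. -/
lemma toBase_hodge_parity_mul (ω ν : Ω) :
    C.toBase (K.hodge (C.parity ω * C.conj ν)) = C.toBase (K.hodge (ω * C.conj (C.parity ν))) := by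
  induction ω using K.toComplexStructure.induction with
  | hz => simp
  | ha ω ω' h1 h2 => simp only [add_mul, map_add, h1, h2]
  | hb p ω h =>
    induction ν using K.toComplexStructure.induction with
    | hz => simp
    | ha ν ν' h1 h2 => simp only [mul_add, map_add, h1, h2]
    | hb q ν h' =>
      rw [K.parity_of_mem h, K.parity_of_mem h', map_smulₛₗ, smul_mul_assoc, mul_smul_comm,
        map_smul, map_smul, map_smul, map_smul]
      by_cases hpq : p + q.swap = (n, n)
      · obtain ⟨a, b⟩ := p
        obtain ⟨a', b'⟩ := q
        simp only [Prod.swap_prod_mk, Prod.mk_add_mk, Prod.mk.injEq] at hpq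
        congr 1
        simp only [map_pow, map_neg, map_one]
        rw [neg_one_pow_congr]
        simp only [Nat.even_iff]
        omega
      · rw [K.toBase_hodge_mul_eq_zero hpq h h', smul_zero, smul_zero]

/-- The degree projections in the definition of the metric are redundant: forms of different degrees
r and s give a product of degree r + 2n - s ≠ 2n, on which `toBase ∘ hodge` vanishes. In this form
the metric has no sum over degrees, so adjoints can be read off directly. -/
lemma metric_eq (ω ν : Ω) : K.metric ω ν = C.toBase (K.hodge (ω * C.conj (K.hodge ν))) := by
  induction ω using K.toComplexStructure.induction with
  | hz => simp [metric]
  | ha ω ω' h1 h2 =>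
    rw [add_mul, map_add, map_add, ← h1, ← h2]
    simp only [metric, map_add, add_mul, Finset.sum_add_distrib]
  | hb p ω h =>
    induction ν using K.lefschetz_induction with
    | hz => simp [metric]
    | ha ν ν' h1 h2 =>
      rw [map_add, map_add, mul_add, map_add, map_add, ← h1, ← h2]
      simp only [metric, map_add, mul_add, Finset.sum_add_distrib]
    | hb a b j ν h' hj =>
      have hν := K.bideg_le _ (K.lefschetz_pow_mem j h'.1)
      have hω := K.bideg_le _ h
      simp only at hν
      set r := a + j + (b + j) with hr
      have hr' : r ≤ 2 * n := by omega
      rw [metric, Finset.sum_eq_single r]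
      · rw [C.proj_same hν, ← K.hodge_conj]
        by_cases hpr : p.1 + p.2 = r
        · rw [C.proj_same (hpr ▸ hω)]
        · rw [C.proj_ne hω hpr, K.hodge_conj, K.hodge_apply h' hj, zero_mul, map_zero, map_zero,
            map_smulₛₗ, mul_smul_comm, map_smul, map_smul, K.toBase_hodge_mul_eq_zero _ h
              (K.lefschetz_pow_mem _ h'.1), smul_zero]
          intro e
          have e1 := congrArg Prod.fst e
          have e2 := congrArg Prod.snd e
          simp at e1 e2
          omega
      · intro s _ hs
        rw [C.proj_ne hν hs.symm]; simp
      · intro hs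
        simp at hs; omega

/-- As κ is central and real, it can be moved from ω into the conjugated factor, where `κ * hodge ν
= hodge (Λ ν)` by the definition of Λ. -/
lemma metric_lefschetz (ω ν : Ω) :
    K.metric (K.lefschetz ω) ν = K.metric ω (K.dualLefschetz ν) := by
  rw [metric_eq, metric_eq, hodge_dualLefschetz, conj_kappa_mul, ← mul_assoc, ← K.κ_central]
  rfl

end HermitianStructure

/-! ### The Kähler identities on scalar forms. -/

namespace HermitianStructure

variable {B Ω : Type*} [Ring B] [StarRing B] [Algebra ℂ B] [StarModule ℂ B]
  [Ring Ω] [Algebra ℂ Ω] {C : DifferentialStarCalculus B Ω} {n : ℕ}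
  (K : HermitianStructure C n)

lemma lefschetz_apply (ω : Ω) : K.lefschetz ω = K.κ * ω := rfl

lemma lefschetz_pow_succ_apply (m : ℕ) (ω : Ω) :
    (K.lefschetz ^ (m + 1)) ω = (K.lefschetz ^ m) (K.lefschetz ω) := rfl

lemma lefschetz_pow_succ_apply' (m : ℕ) (ω : Ω) :
    (K.lefschetz ^ (m + 1)) ω = K.lefschetz ((K.lefschetz ^ m) ω) := by
  rw [pow_succ']; rfl

lemma hodgeCoeff_succ {a b j m : ℕ} (hn : n = a + b + j + 1 + m) :
    hodgeCoeff n a b (j + 1) = ((j : ℂ) + 1) * (m + 1) * hodgeCoeff n a b j := by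
  have e1 : n - (j + 1) - (a + b) = m := by omega
  have e2 : n - j - (a + b) = m + 1 := by omega
  have h1 : ((m.factorial : ℕ) : ℂ) ≠ 0 := by exact_mod_cast m.factorial_ne_zero
  have h2 : (m : ℂ) + 1 ≠ 0 := by exact_mod_cast m.succ_ne_zero
  simp only [hodgeCoeff, e1, e2, Nat.factorial_succ]
  push_cast
  field_simp

/-- The action of `Λ` on the Lefschetz decomposition. -/
lemma dualLefschetz_lefschetz_pow_succ {a b j m : ℕ} (hn : n = a + b + j + m) {ω : Ω}
    (h : ω ∈ K.primitive (a, b)) :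
    K.dualLefschetz ((K.lefschetz ^ (j + 1)) ω) =
      (((j : ℂ) + 1) * m) • (K.lefschetz ^ j) ω := by
  apply K.hodge_bijective.1
  rw [hodge_dualLefschetz]
  rcases m with _ | m
  -- For m = 0, j is already the last power with L ^ j ω possibly non-zero, and the coefficient (j +
  -- 1) m vanishes as well.
  · rw [K.lefschetz_pow_eq_zero h (by simp only; omega)]; simp
  · rw [K.hodge_apply h (by omega), map_smul, K.hodge_apply h (by omega),
      hodgeCoeff_succ (n := n) (m := m) (by omega), mul_smul_comm, smul_smul,
      show n - j - (a + b) = n - (j + 1) - (a + b) + 1 by omega, lefschetz_pow_succ_apply']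
    push_cast
    rfl

lemma dualLefschetz_primitive {a b : ℕ} {ω : Ω} (hab : a + b ≤ n) (h : ω ∈ K.primitive (a, b)) :
    K.dualLefschetz ω = 0 := by
  apply K.hodge_bijective.1
  have := K.hodge_apply (j := 0) h (by omega)
  rw [pow_zero, Module.End.one_apply] at this
  rw [hodge_dualLefschetz, this, map_zero, mul_smul_comm, ← lefschetz_apply,
    ← lefschetz_pow_succ_apply', K.lefschetz_pow_eq_zero h (by simp only; omega), smul_zero]

/-- A form of degree `k + 1` annihilated by `L ^ (n - k + 1)` is of the form `α + L β` for primitive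
forms `α` and `β`. -/
lemma exists_primitive_add_lefschetz {a b : ℕ} (hab : a + b ≤ n) {ω : Ω}
    (h : ω ∈ K.bideg (a, b + 1)) (h0 : (K.lefschetz ^ (n + 1 - (a + b))) ω = 0) :
    ∃ α ∈ K.primitive (a, b + 1), ∃ β, ω = α + K.lefschetz β ∧
      (β = 0 ∨ ∃ c, a = c + 1 ∧ β ∈ K.primitive (c, b)) := by
  have hm := K.lefschetz_pow_mem (n - (a + b)) h
  simp only at hm
  rcases a with _ | a
  -- With a = 0 there is no bidegree (a - 1, b) for β, so ω itself must be primitive.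
  · refine ⟨ω, ⟨h, ?_⟩, 0, by simp, Or.inl rfl⟩
    change (K.lefschetz ^ (n + 1 - (0 + (b + 1)))) ω = 0
    rcases b with _ | b
    · have hd := K.bideg_le _ hm
      rw [K.above_top _ (by simp only; omega)] at hd
      exact (Submodule.mem_bot ℂ).mp hd
    · obtain ⟨β, hβ, hβe⟩ := (K.lefschetz_bijOn b (by omega)).surjOn
        (show (K.lefschetz ^ (n - (0 + (b + 1)))) ω ∈ C.deg (2 * n - b) by
          convert K.bideg_le _ hm using 2; simp only; omega)
      simp only [← lefschetz_pow_apply] at hβe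
      -- By Lefschetz, L ^ (n - b - 1) ω lies in the image of L ^ (n - b), whose bidegrees have
      -- first entry at least n - b. Its own first entry is n - b - 1, so it vanishes.
      have e : K.biproj (0 + (n - (0 + (b + 1))), b + 1 + 1 + (n - (0 + (b + 1))))
          ((K.lefschetz ^ (n - b)) β) = 0 := by
        suffices H : ∀ ν, K.biproj (0 + (n - (0 + (b + 1))), b + 1 + 1 + (n - (0 + (b + 1))))
          ((K.lefschetz ^ (n - b)) ν) = 0 from H β
        intro ν
        induction ν using K.toComplexStructure.induction with
        | hz => simp
        | ha ω ν h1 h2 => simp only [map_add, h1, h2, add_zero]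
        | hb p ν hν =>
          refine K.biproj_ne (K.lefschetz_pow_mem _ hν) ?_
          simp only [ne_eq, Prod.mk.injEq, not_and]
          omega
      rw [hβe, K.biproj_same hm] at e
      convert e using 3
      omega
  -- The candidate β solves L ^ (n - a - b) β = L ^ (n - a - b - 1) ω; only its (a, b) component γ
  -- matters. Then ω - Lγ is primitive by construction, and one more factor `L` with `h0` shows that
  -- γ is primitive.
  · obtain ⟨β, hβ, hβe⟩ := (K.lefschetz_bijOn (a + b) (by omega)).surjOn
      (show (K.lefschetz ^ (n - (a + 1 + b))) ω ∈ C.deg (2 * n - (a + b)) by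
        convert K.bideg_le _ hm using 2; simp only; omega)
    simp only [← lefschetz_pow_apply] at hβe
    have e := K.biproj_lefschetz_pow (n - (a + b)) (a, b) β
    rw [hβe, K.biproj_same] at e
    swap
    · convert hm using 2
      simp only [Prod.mk.injEq]; omega
    have hγ := K.biproj_mem (a, b) β
    generalize K.biproj (a, b) β = γ at e hγ
    have hL : K.lefschetz γ ∈ K.bideg (a + 1, b + 1) := by
      simpa using K.lefschetz_pow_mem 1 hγ
    refine ⟨ω - K.lefschetz γ, ⟨sub_mem h hL, ?_⟩, γ, by simp, Or.inr ⟨a, rfl, hγ, ?_⟩⟩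
    · change (K.lefschetz ^ (n + 1 - (a + 1 + (b + 1)))) _ = 0
      rw [map_sub, ← lefschetz_pow_succ_apply, sub_eq_zero,
        show n + 1 - (a + 1 + (b + 1)) + 1 = n - (a + b) by omega, ← e]
      congr 2; omega
    · change (K.lefschetz ^ (n + 1 - (a + b))) _ = 0
      rw [show n + 1 - (a + b) = n - (a + b) + 1 by omega, lefschetz_pow_succ_apply', ← e,
        ← lefschetz_pow_succ_apply', ← h0]
      congr 2; omega

/-- Two consecutive triangular numbers add up to the square (k + 1)², which has the parity of k + 1.
-/
lemma neg_one_pow_triangle (k : ℕ) :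
    (-1 : ℂ) ^ (k * (k + 1) / 2) * (-1) ^ ((k + 1) * (k + 1 + 1) / 2) = (-1) ^ (k + 1) := by
  have e : k * (k + 1) / 2 + (k + 1) * (k + 1 + 1) / 2 = (k + 1) * (k + 1) := by
    obtain ⟨r, hr⟩ := Nat.even_mul_succ_self k
    have h2 : (k + 1) * (k + 1 + 1) = 2 * (r + (k + 1)) := by linarith
    have h3 : k * (k + 1) = 2 * r := by linarith
    rw [h2, h3, Nat.mul_div_cancel_left _ two_pos, Nat.mul_div_cancel_left _ two_pos]
    linarith
  rw [← pow_add, e, pow_mul]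
  rcases Nat.even_or_odd (k + 1) with h | h
  · simp [h.neg_one_pow]
  · simp [h.neg_one_pow]

lemma I_zpow_mul_pred (a b : ℕ) :
    Complex.I ^ ((a : ℤ) - b) * Complex.I ^ ((a : ℤ) - b - 1) = (-1) ^ (a + b) * -Complex.I := by
  have h1 : (-1 : ℂ) ^ b * (-1) ^ b = 1 := by rw [← mul_pow]; simp
  rw [zpow_sub₀ Complex.I_ne_zero _ 1, mul_div_assoc', ← mul_zpow, Complex.I_mul_I,
    zpow_sub₀ (by norm_num), zpow_natCast, zpow_natCast, zpow_one, div_eq_mul_inv _ Complex.I,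
    Complex.inv_I]
  congr 1
  rw [div_eq_iff (by simp), pow_add, mul_assoc, h1, mul_one]

/-- The coefficient that * T * produces on the primitive component α of Tω, when applied to L ^ (j +
1) ω. -/
lemma hodgeCoeff_mul_left {a b j m : ℕ} (hn : n = a + b + (j + 1) + m) :
    hodgeCoeff n a b (j + 1) * hodgeCoeff n a (b + 1) m = Complex.I * (j + 1) := by
  have e1 : n - (j + 1) - (a + b) = m := by omega
  have e2 : n - m - (a + (b + 1)) = j := by omega
  have f1 : ((m.factorial : ℕ) : ℂ) ≠ 0 := by exact_mod_cast m.factorial_ne_zero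
  have f2 : ((j.factorial : ℕ) : ℂ) ≠ 0 := by exact_mod_cast j.factorial_ne_zero
  have hs := neg_one_pow_triangle (a + b)
  have hI := I_zpow_mul_pred a b
  have h1 : (-1 : ℂ) ^ (a + b) * (-1) ^ (a + b) = 1 := by rw [← mul_pow]; simp
  simp only [hodgeCoeff, e1, e2, Nat.factorial_succ]
  push_cast
  rw [← add_assoc a b 1, show (a : ℤ) - (b + 1) = a - b - 1 by ring]
  calc _ = ((-1 : ℂ) ^ ((a + b) * (a + b + 1) / 2) * (-1) ^ ((a + b + 1) * (a + b + 1 + 1) / 2)) *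
      (Complex.I ^ ((a : ℤ) - b) * Complex.I ^ ((a : ℤ) - b - 1)) *
      (((j : ℂ) + 1) * j.factorial / m.factorial * (m.factorial / j.factorial)) := by ring
    _ = ((-1 : ℂ) ^ (a + b) * (-1) ^ (a + b)) * Complex.I *
      (((j : ℂ) + 1) * j.factorial / m.factorial * (m.factorial / j.factorial)) := by
        rw [hs, hI]; ring
    _ = _ := by rw [h1]; field_simp

/-- The coefficient that * T * produces on the component Lβ of Tω; here ω has type (a + 1, b), so β
has type (a, b). -/
lemma hodgeCoeff_mul_right {a b j m : ℕ} (hn : n = a + 1 + b + j + m) :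
    hodgeCoeff n (a + 1) b j * hodgeCoeff n a b (m + 1) = -Complex.I * (m + 1) := by
  have e1 : n - j - (a + 1 + b) = m := by omega
  have e2 : n - (m + 1) - (a + b) = j := by omega
  have f1 : ((m.factorial : ℕ) : ℂ) ≠ 0 := by exact_mod_cast m.factorial_ne_zero
  have f2 : ((j.factorial : ℕ) : ℂ) ≠ 0 := by exact_mod_cast j.factorial_ne_zero
  have hs := neg_one_pow_triangle (a + b)
  have hI := I_zpow_mul_pred (a + 1) b
  have h1 : (-1 : ℂ) ^ (a + b + 1) * (-1) ^ (a + b + 1) = 1 := by rw [← mul_pow]; simp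
  simp only [hodgeCoeff, e1, e2, Nat.factorial_succ]
  rw [show a + 1 + b = a + b + 1 by omega] at hI ⊢
  rw [show (a : ℤ) - b = ((a + 1 : ℕ) : ℤ) - b - 1 by push_cast; ring]
  push_cast at hI ⊢
  calc _ = ((-1 : ℂ) ^ ((a + b) * (a + b + 1) / 2) * (-1) ^ ((a + b + 1) * (a + b + 1 + 1) / 2)) *
      (Complex.I ^ ((a : ℤ) + 1 - b) * Complex.I ^ ((a : ℤ) + 1 - b - 1)) *
      (j.factorial / m.factorial * (((m : ℂ) + 1) * m.factorial / j.factorial)) := by ring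
    _ = ((-1 : ℂ) ^ (a + b + 1) * (-1) ^ (a + b + 1)) * -Complex.I *
      (j.factorial / m.factorial * (((m : ℂ) + 1) * m.factorial / j.factorial)) := by
        rw [hs, hI]; ring
    _ = _ := by rw [h1]; field_simp

/-- The Kähler identity `[Λ, T] = i * T *` for an operator `T` of bidegree `(0, 1)` that commutes
with `L`. -/
lemma dualLefschetz_commutator_of_zero_one {T : Ω →ₗ[ℂ] Ω}
    (hT : ∀ a b, ∀ ω ∈ K.bideg (a, b), T ω ∈ K.bideg (a, b + 1))
    (hL : ∀ ω, T (K.κ * ω) = K.κ * T ω) (ω : Ω) :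
    K.dualLefschetz (T ω) - T (K.dualLefschetz ω) = Complex.I • K.hodge (T (K.hodge ω)) := by
  have hLm : ∀ m ω, T ((K.lefschetz ^ m) ω) = (K.lefschetz ^ m) (T ω) := by
    intro m
    induction m with
    | zero => simp
    | succ m ih => intro ω; rw [lefschetz_pow_succ_apply, ih, lefschetz_apply, hL]; rfl
  induction ω using K.lefschetz_induction with
  | hz => simp
  | ha ω ν h1 h2 =>
    simp only [map_add, smul_add, ← h1, ← h2]; abel
  | hb a b j ω h hj =>
    obtain ⟨m, hm⟩ : ∃ m, n = a + b + j + m := ⟨n - (a + b + j), by omega⟩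
    -- Since T commutes with `L`, Tω is killed by the same power of `L` as ω. Hence it has only two
    -- Lefschetz components, and the identity reduces to comparing the coefficients of α and β: -j
    -- and m + 1 on both sides.
    obtain ⟨α, hα, β, hTω, hβ⟩ := K.exists_primitive_add_lefschetz (by omega) (hT a b ω h.1)
      (by rw [← hLm, show (K.lefschetz ^ (n + 1 - (a + b))) ω = 0 from h.2, map_zero])
    have em : n - j - (a + b) = m := by omega
    -- the contributions of `β`
    have hβ1 : K.dualLefschetz ((K.lefschetz ^ (j + 1)) β) =
        (((j : ℂ) + 1) * (m + 1)) • (K.lefschetz ^ j) β := by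
      rcases hβ with rfl | ⟨c, rfl, hc⟩
      · simp
      · rw [K.dualLefschetz_lefschetz_pow_succ (m := m + 1) (by omega) hc]; push_cast; rfl
    have hβ2 : hodgeCoeff n a b j • K.hodge ((K.lefschetz ^ (m + 1)) β) =
        (-Complex.I * (m + 1)) • (K.lefschetz ^ j) β := by
      rcases hβ with rfl | ⟨c, rfl, hc⟩
      · simp
      · rw [K.hodge_apply hc (by omega), smul_smul, hodgeCoeff_mul_right (by omega),
          show n - (m + 1) - (c + b) = j by omega]
    have hI : Complex.I * Complex.I = -1 := Complex.I_mul_I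
    rw [hLm, hTω, map_add, ← lefschetz_pow_succ_apply, map_add, hβ1, K.hodge_apply h hj, em,
      map_smul, map_smul, hLm, hTω, map_add, ← lefschetz_pow_succ_apply, map_add, smul_add, hβ2]
    rcases j with _ | j
    -- For j = 0 every α contribution vanishes. If a + b = n, then α has degree n + 1, where the
    -- exponent defining primitivity truncates to 0 and forces α = 0.
    · have e1 : K.dualLefschetz ((K.lefschetz ^ 0) α) = 0 := by
        by_cases hab : a + b + 1 ≤ n
        · exact K.dualLefschetz_primitive (by omega) hα
        · rw [K.lefschetz_pow_eq_zero hα (by simp only; omega), map_zero]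
      have e2 : K.dualLefschetz ((K.lefschetz ^ 0) ω) = 0 :=
        K.dualLefschetz_primitive (by omega) h
      have e3 : (K.lefschetz ^ m) α = 0 := K.lefschetz_pow_eq_zero hα (by simp only; omega)
      rw [e1, e2, e3]
      simp only [map_zero, smul_zero, zero_add, sub_zero, smul_smul]
      congr 1
      push_cast
      linear_combination ((m : ℂ) + 1) * hI
    · have e1 : K.dualLefschetz ((K.lefschetz ^ (j + 1)) α) =
          (((j : ℂ) + 1) * m) • (K.lefschetz ^ j) α :=
        K.dualLefschetz_lefschetz_pow_succ (by omega) hα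
      have e2 : K.dualLefschetz ((K.lefschetz ^ (j + 1)) ω) =
          (((j : ℂ) + 1) * (m + 1)) • (K.lefschetz ^ j) ω := by
        rw [K.dualLefschetz_lefschetz_pow_succ (m := m + 1) (by omega) h]; push_cast; rfl
      rw [e1, e2, K.hodge_apply hα (by omega), smul_smul, hodgeCoeff_mul_left hm,
        map_smul, hLm, hTω, map_add, ← lefschetz_pow_succ_apply,
        show n - m - (a + (b + 1)) = j by omega]
      simp only [smul_add, smul_smul]
      push_cast
      rw [show Complex.I * (Complex.I * ((j : ℂ) + 1)) = -(j + 1) by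
          linear_combination ((j : ℂ) + 1) * hI,
        show Complex.I * (-Complex.I * ((m : ℂ) + 1)) = m + 1 by
          linear_combination (-(m : ℂ) - 1) * hI]
      module

/-- The Kähler identity `[Λ, T] = -i * T *` for an operator `T` of bidegree `(1, 0)` that commutes
with `L`. -/
lemma dualLefschetz_commutator_of_one_zero {T : Ω →ₗ[ℂ] Ω}
    (hT : ∀ a b, ∀ ω ∈ K.bideg (a, b), T ω ∈ K.bideg (a + 1, b))
    (hL : ∀ ω, T (K.κ * ω) = K.κ * T ω) (ω : Ω) :
    K.dualLefschetz (T ω) - T (K.dualLefschetz ω) = -(Complex.I • K.hodge (T (K.hodge ω))) := by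
  -- The conjugate of T is complex linear, of bidegree (0, 1), and commutes with `L`; conjugating
  -- its identity back turns i into -i.
  let S : Ω →ₗ[ℂ] Ω := (C.conj.comp T).comp C.conj
  have hS : ∀ ν, S ν = C.conj (T (C.conj ν)) := fun _ => rfl
  have key := K.dualLefschetz_commutator_of_zero_one (T := S)
    (fun a b ν hν => (K.conj_mem _ _ _).2 (hT _ _ _ ((K.conj_mem _ _ _).2 hν)))
    (fun ν => by simp only [hS, conj_kappa_mul, hL]) (C.conj ω)
  simp only [hS, conj_dualLefschetz, hodge_conj, C.conj_conj] at key
  have key' := congrArg C.conj key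
  simpa only [map_sub, map_smulₛₗ, Complex.conj_I, C.conj_conj, neg_smul] using key'

end HermitianStructure

/-! ### Forms with values in a module and the extension of connections. -/

section TwistedForms

variable {B Ω : Type*} [Ring B] [Algebra ℂ B] [Ring Ω] [Algebra ℂ Ω]
  (C : DifferentialCalculus B Ω)
  {F : Type*} [AddCommGroup F] [Module B F] [Module ℂ F]

lemma tmulB_zero_left (f : F) : tmulB C 0 f = 0 := by
  simpa using tmulB_smul_left C 0 0 f

lemma tmulB_neg_left (ω : Ω) (f : F) : tmulB C (-ω) f = -tmulB C ω f := by
  simpa using tmulB_smul_left C (-1) ω f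

lemma tmulB_sub_left (ω ν : Ω) (f : F) : tmulB C (ω - ν) f = tmulB C ω f - tmulB C ν f := by
  rw [sub_eq_add_neg, tmulB_add_left, tmulB_neg_left, sub_eq_add_neg]

lemma wedge_neg (ω : Ω) (α : TwistedForms C F) : wedge C F (-ω) α = -wedge C F ω α := by
  simpa using wedge_smul C (-1) ω α

lemma wedge_one (α : TwistedForms C F) : wedge C F 1 α = α := by
  induction α using TwistedForms.induction with
  | hz => simp
  | ht => simp
  | ha α β h1 h2 => rw [map_add, h1, h2]

-- The predicate need not be stable under scalars: a scalar multiple of ω ⊗ f is again an elementary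
-- tensor with first factor in `W`. The proof therefore carries all multiples c • α along.
variable {C} in
lemma valuedIn_induction {W : Submodule ℂ Ω} {motive : TwistedForms C F → Prop} (hz : motive 0)
    (ht : ∀ ω ∈ W, ∀ f, motive (tmulB C ω f))
    (ha : ∀ α β, motive α → motive β → motive (α + β)) {α : TwistedForms C F}
    (h : α ∈ valuedIn C F W) : motive α := by
  have key : ∀ α ∈ valuedIn C F W, ∀ c : ℂ, motive (c • α) := by
    intro α h
    induction h using Submodule.span_induction with
    | mem x hx =>
      obtain ⟨ω, hω, f, rfl⟩ := hx
      intro c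
      rw [← tmulB_smul_left]
      exact ht _ (W.smul_mem c hω) f
    | zero => intro c; rwa [smul_zero]
    | add x y _ _ hx hy => intro c; rw [smul_add]; exact ha _ _ (hx c) (hy c)
    | smul a x _ hx => intro c; rw [smul_smul]; exact hx _
  simpa using key α h 1

variable {C} in
lemma valuedIn_mono {W W' : Submodule ℂ Ω} (h : W ≤ W') : valuedIn C F W ≤ valuedIn C F W' :=
  Submodule.span_mono fun _ ⟨ω, hω, f, e⟩ => ⟨ω, h hω, f, e⟩

variable {C} in
lemma tmulB_mem_valuedIn {W : Submodule ℂ Ω} {ω : Ω} (h : ω ∈ W) (f : F) :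
    tmulB C ω f ∈ valuedIn C F W := Submodule.subset_span ⟨ω, h, f, rfl⟩

variable (F) in
/-- The parity operator on `Ω ⊗_B F`. -/
def twistedParity : Module.End ℂ (TwistedForms C F) := mapB C F C.parity C.parity_mul_incl

@[simp] lemma twistedParity_tmulB (ω : Ω) (f : F) :
    twistedParity C F (tmulB C ω f) = tmulB C (C.parity ω) f := rfl

lemma twistedParity_wedge (ω : Ω) {α : TwistedForms C F} (h : α ∈ valuedIn C F (C.deg 1)) :
    twistedParity C F (wedge C F ω α) = -wedge C F (C.parity ω) α := by
  refine valuedIn_induction (motive := fun α => twistedParity C F (wedge C F ω α) =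
    -wedge C F (C.parity ω) α) (by simp) (fun η hη f => ?_) (fun α β h1 h2 => ?_) h
  · simp only [wedge_tmulB, twistedParity_tmulB, C.parity_mul, C.parity_of_mem hη, pow_one,
      neg_smul, one_smul, mul_neg, tmulB_neg_left]
  · simp only [map_add, h1, h2, neg_add]

section extend

variable {δ : Ω →ₗ[ℂ] Ω}
  {hδ : ∀ ω b, δ (ω * C.incl b) = δ ω * C.incl b + C.parity ω * δ (C.incl b)}
  {D : F →ₗ[ℂ] TwistedForms C F}
  {hD : ∀ b f, D (b • f) = tmulB C (δ (C.incl b)) f + wedge C F (C.incl b) (D f)}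

lemma extend_tmulB (ω : Ω) (f : F) : extend C δ hδ D hD (tmulB C ω f) =
    tmulB C (δ ω) f + wedge C F (C.parity ω) (D f) := rfl

variable {C}

lemma extend_one_tmulB (h : C.IsDifferential δ) (f : F) :
    extend C δ hδ D hD (tmulB C 1 f) = D f := by
  rw [extend_tmulB, h.map_one, C.parity_one, tmulB_zero_left, wedge_one, zero_add]

lemma extend_wedge (h : C.IsDifferential δ) (ω : Ω) (α : TwistedForms C F) :
    extend C δ hδ D hD (wedge C F ω α) =
      wedge C F (δ ω) α + wedge C F (C.parity ω) (extend C δ hδ D hD α) := by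
  induction α using TwistedForms.induction with
  | hz => simp
  | ha α β h1 h2 => simp only [map_add, h1, h2]; abel
  | ht ν f =>
    rw [wedge_tmulB, extend_tmulB, extend_tmulB, h.map_mul, C.parity_mul, tmulB_add_left, map_add,
      wedge_tmulB, wedge_tmulB, wedge_wedge]
    abel

lemma twistedParity_extend (h : C.IsDifferential δ) (hm : ∀ f, D f ∈ valuedIn C F (C.deg 1))
    (α : TwistedForms C F) :
    twistedParity C F (extend C δ hδ D hD α) = -extend C δ hδ D hD (twistedParity C F α) := by
  induction α using TwistedForms.induction with
  | hz => simp
  | ha α β h1 h2 => simp only [map_add, h1, h2, neg_add]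
  | ht ω f =>
    rw [extend_tmulB, map_add, twistedParity_tmulB, h.parity, twistedParity_wedge _ _ (hm f),
      twistedParity_tmulB, extend_tmulB, tmulB_neg_left, neg_add]

/-- In the square applied to ω ⊗ f, the two cross terms containing δω ∧ Df cancel because δ is odd;
there remain δ²ω ⊗ f and ω ∧ D²f. -/
lemma extend_extend (h : C.IsDifferential δ) (h0 : ∀ f, extend C δ hδ D hD (D f) = 0)
    (α : TwistedForms C F) : extend C δ hδ D hD (extend C δ hδ D hD α) = 0 := by
  induction α using TwistedForms.induction with
  | hz => simp
  | ha α β h1 h2 => simp only [map_add, h1, h2, add_zero]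
  | ht ω f =>
    rw [extend_tmulB, map_add, extend_tmulB, extend_wedge h, h.sq, h0, tmulB_zero_left, h.parity,
      wedge_neg, map_zero]
    abel

/-- A commutator identity on forms passes to forms with values in a module. -/
lemma mapB_extend_commutator {X Y : Ω →ₗ[ℂ] Ω} {hX : ∀ ω b, X (ω * C.incl b) = X ω * C.incl b}
    {hY : ∀ ω b, Y (ω * C.incl b) = Y ω * C.incl b} {W : Submodule ℂ Ω} {c : ℂ}
    (h1 : ∀ ω, X (δ ω) - δ (X ω) = c • Y (δ (Y ω)))
    (h2 : ∀ η ∈ W, ∀ ω, X (C.parity ω * η) - C.parity (X ω) * η = c • Y (C.parity (Y ω) * η))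
    (hm : ∀ f, D f ∈ valuedIn C F W) (α : TwistedForms C F) :
    mapB C F X hX (extend C δ hδ D hD α) - extend C δ hδ D hD (mapB C F X hX α) =
      c • mapB C F Y hY (extend C δ hδ D hD (mapB C F Y hY α)) := by
  -- This is the part of the commutator coming from the connection term (-1)^|ω| ω ∧ Df; `h1` covers
  -- the part coming from δω ⊗ f.
  have key : ∀ ω, ∀ β ∈ valuedIn C F W,
      mapB C F X hX (wedge C F (C.parity ω) β) - wedge C F (C.parity (X ω)) β =
        c • mapB C F Y hY (wedge C F (C.parity (Y ω)) β) := by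
    intro ω β hβ
    refine valuedIn_induction (motive := fun β =>
      mapB C F X hX (wedge C F (C.parity ω) β) - wedge C F (C.parity (X ω)) β =
        c • mapB C F Y hY (wedge C F (C.parity (Y ω)) β)) (by simp) (fun η hη f => ?_)
      (fun α β e1 e2 => ?_) hβ
    · simp only [wedge_tmulB, mapB_tmulB]
      rw [← tmulB_sub_left, ← tmulB_smul_left, h2 η hη]
    · simp only [map_add, smul_add, ← e1, ← e2]; abel
  induction α using TwistedForms.induction with
  | hz => simp
  | ha α β e1 e2 => simp only [map_add, smul_add, ← e1, ← e2]; abel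
  | ht ω f =>
    simp only [extend_tmulB, mapB_tmulB, map_add, smul_add]
    rw [← key ω _ (hm f), ← tmulB_smul_left, ← h1, tmulB_sub_left]
    abel

end extend

end TwistedForms

/-! ### The Hermitian pairing on twisted forms. -/

section Pairing

variable {B Ω : Type*} [Ring B] [StarRing B] [Algebra ℂ B] [StarModule ℂ B]
  [Ring Ω] [Algebra ℂ Ω] {C : DifferentialStarCalculus B Ω}
  {F : Type*} [AddCommGroup F] [Module B F] [Module ℂ F] [IsScalarTower ℂ B F]

namespace HermitianModule

set_option linter.unusedSectionVars false

variable (H : HermitianModule B F)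

lemma formPairing_tmulB (ω ν : Ω) (f k : F) :
    H.formPairing C (tmulB C.toDifferentialCalculus ω f) (tmulB C.toDifferentialCalculus ν k) =
      ω * C.incl (H.pairing f k) * C.conj ν := rfl

lemma formPairing_wedge_left (ω : Ω) (α β : TwistedForms C.toDifferentialCalculus F) :
    H.formPairing C (wedge C.toDifferentialCalculus F ω α) β = ω * H.formPairing C α β := by
  induction α using TwistedForms.induction with
  | hz => simp
  | ha α α' h1 h2 => simp only [map_add, LinearMap.add_apply, h1, h2, mul_add]
  | ht η f =>
    induction β using TwistedForms.induction with
    | hz => simp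
    | ha β β' h1 h2 => simp only [map_add, h1, h2, mul_add]
    | ht ν k => rw [wedge_tmulB, formPairing_tmulB, formPairing_tmulB]; simp only [mul_assoc]

lemma formPairing_tmulB_right (α : TwistedForms C.toDifferentialCalculus F) (ν : Ω) (k : F) :
    H.formPairing C α (tmulB C.toDifferentialCalculus ν k) =
      H.formPairing C α (tmulB C.toDifferentialCalculus 1 k) * C.conj ν := by
  have h1 : C.conj 1 = 1 := by simpa using C.conj_incl 1
  induction α using TwistedForms.induction with
  | hz => simp
  | ha α α' h1 h2 => simp only [map_add, LinearMap.add_apply, h1, h2, add_mul]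
  | ht ω f => rw [formPairing_tmulB, formPairing_tmulB, h1, mul_one]

lemma formPairing_tmulB_left (ω : Ω) (f : F) (β : TwistedForms C.toDifferentialCalculus F) :
    H.formPairing C (tmulB C.toDifferentialCalculus ω f) β =
      ω * H.formPairing C (tmulB C.toDifferentialCalculus 1 f) β := by
  rw [← formPairing_wedge_left, wedge_tmulB, mul_one]

/-- Conjugating ν ∧ η with η of degree one creates the sign (-1)^|ν|, which the parity operator
cancels. This is why no sign remains in the second variable of the Leibniz rule. -/
lemma formPairing_wedge_right (α : TwistedForms C.toDifferentialCalculus F) (ν : Ω)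
    {β : TwistedForms C.toDifferentialCalculus F}
    (hβ : β ∈ valuedIn C.toDifferentialCalculus F (C.deg 1)) :
    H.formPairing C α (wedge C.toDifferentialCalculus F (C.parity ν) β) =
      H.formPairing C α β * C.conj ν := by
  refine valuedIn_induction (motive := fun β =>
    H.formPairing C α (wedge C.toDifferentialCalculus F (C.parity ν) β) =
      H.formPairing C α β * C.conj ν) (by simp) (fun η hη k => ?_) (fun β β' h1 h2 => ?_) hβ
  · rw [wedge_tmulB, formPairing_tmulB_right, formPairing_tmulB_right _ _ η, mul_assoc]
    congr 1
    induction ν using C.induction with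
    | hz => simp
    | ha ν ν' h1 h2 => simp only [map_add, add_mul, mul_add, h1, h2]
    | hb l ν hν =>
      rw [C.parity_of_mem hν, smul_mul_assoc, map_smulₛₗ, C.conj_mul l 1 _ hν _ hη, smul_smul,
        mul_one, map_pow, map_neg, map_one, ← mul_pow]
      simp
  · simp only [map_add, h1, h2, add_mul]

lemma conj_formPairing_one (ω : Ω) (f k : F) :
    C.conj (H.formPairing C (tmulB C.toDifferentialCalculus ω f)
      (tmulB C.toDifferentialCalculus 1 k)) =
    H.formPairing C (tmulB C.toDifferentialCalculus 1 k) (tmulB C.toDifferentialCalculus ω f) := by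
  have h1 : C.conj 1 = 1 := by simpa using C.conj_incl 1
  rw [formPairing_tmulB, formPairing_tmulB, h1, mul_one, one_mul, C.conj_mul_incl]
  congr 2
  exact (H.symm k f).symm

lemma conj_formPairing (α : TwistedForms C.toDifferentialCalculus F) (k : F) :
    C.conj (H.formPairing C α (tmulB C.toDifferentialCalculus 1 k)) =
      H.formPairing C (tmulB C.toDifferentialCalculus 1 k) α := by
  induction α using TwistedForms.induction with
  | hz => simp
  | ha α β h1 h2 => simp only [map_add, LinearMap.add_apply, h1, h2]
  | ht ω f => exact H.conj_formPairing_one ω f k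

lemma conj_formPairing' (α : TwistedForms C.toDifferentialCalculus F) (k : F) :
    C.conj (H.formPairing C (tmulB C.toDifferentialCalculus 1 k) α) =
      H.formPairing C α (tmulB C.toDifferentialCalculus 1 k) := by
  rw [← conj_formPairing, C.conj_conj]

section Leibniz

variable {H} {δ₁ δ₂ : Ω →ₗ[ℂ] Ω}
  {hδ₁ : ∀ ω b, δ₁ (ω * C.incl b) = δ₁ ω * C.incl b + C.parity ω * δ₁ (C.incl b)}
  {hδ₂ : ∀ ω b, δ₂ (ω * C.incl b) = δ₂ ω * C.incl b + C.parity ω * δ₂ (C.incl b)}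
  {D₁ D₂ : F →ₗ[ℂ] TwistedForms C.toDifferentialCalculus F}
  {hD₁ : ∀ b f, D₁ (b • f) = tmulB C.toDifferentialCalculus (δ₁ (C.incl b)) f +
    wedge C.toDifferentialCalculus F (C.incl b) (D₁ f)}
  {hD₂ : ∀ b f, D₂ (b • f) = tmulB C.toDifferentialCalculus (δ₂ (C.incl b)) f +
    wedge C.toDifferentialCalculus F (C.incl b) (D₂ f)}

/-- The Leibniz rule for the pairing of forms with values in a module. -/
lemma map_formPairing (h₁ : C.IsDifferential δ₁) (hconj : ∀ ω, δ₁ (C.conj ω) = C.conj (δ₂ ω))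
    (hm : ∀ f, D₂ f ∈ valuedIn C.toDifferentialCalculus F (C.deg 1))
    (hH : ∀ f k, δ₁ (C.incl (H.pairing f k)) =
      H.formPairing C (D₁ f) (tmulB C.toDifferentialCalculus 1 k) +
        H.formPairing C (tmulB C.toDifferentialCalculus 1 f) (D₂ k))
    (α β : TwistedForms C.toDifferentialCalculus F) :
    δ₁ (H.formPairing C α β) =
      H.formPairing C (extend C.toDifferentialCalculus δ₁ hδ₁ D₁ hD₁ α) β +
        H.formPairing C (twistedParity C.toDifferentialCalculus F α)
          (extend C.toDifferentialCalculus δ₂ hδ₂ D₂ hD₂ β) := by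
  induction α using TwistedForms.induction with
  | hz => simp
  | ha α α' e1 e2 => simp only [map_add, LinearMap.add_apply, e1, e2]; abel
  | ht ω f =>
    induction β using TwistedForms.induction with
    | hz => simp
    | ha β β' e1 e2 => simp only [map_add, e1, e2]; abel
    | ht ν k =>
      rw [extend_tmulB, extend_tmulB, twistedParity_tmulB, map_add, map_add, LinearMap.add_apply,
        formPairing_wedge_left, formPairing_wedge_right _ _ _ (hm k), formPairing_tmulB,
        formPairing_tmulB, formPairing_tmulB, formPairing_tmulB_right _ _ ν,
        formPairing_tmulB_left _ (C.parity ω), h₁.map_mul, h₁.map_mul, hH, hconj, C.parity_mul,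
        C.parity_incl]
      simp only [mul_add, add_mul, mul_assoc]
      abel

/-- The curvature of a Hermitian connection has no component of the type of `δ₁ ^ 2` if it has none
of the type of `δ₂ ^ 2`. -/
lemma formPairing_extend_eq_zero (h₁ : C.IsDifferential δ₁) (h₂ : C.IsDifferential δ₂)
    (hconj : ∀ ω, δ₁ (C.conj ω) = C.conj (δ₂ ω))
    (hm₁ : ∀ f, D₁ f ∈ valuedIn C.toDifferentialCalculus F (C.deg 1))
    (hm₂ : ∀ f, D₂ f ∈ valuedIn C.toDifferentialCalculus F (C.deg 1))
    (hH : ∀ f k, δ₁ (C.incl (H.pairing f k)) =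
      H.formPairing C (D₁ f) (tmulB C.toDifferentialCalculus 1 k) +
        H.formPairing C (tmulB C.toDifferentialCalculus 1 f) (D₂ k))
    (hflat : ∀ f, extend C.toDifferentialCalculus δ₂ hδ₂ D₂ hD₂ (D₂ f) = 0) (f k : F) :
    H.formPairing C (extend C.toDifferentialCalculus δ₁ hδ₁ D₁ hD₁ (D₁ f))
      (tmulB C.toDifferentialCalculus 1 k) = 0 := by
  have key := map_formPairing (hδ₁ := hδ₁) (hδ₂ := hδ₂) (hD₁ := hD₁) (hD₂ := hD₂) h₁ hconj hm₂ hH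
  have e := h₁.sq (H.formPairing C (tmulB C.toDifferentialCalculus 1 f)
    (tmulB C.toDifferentialCalculus 1 k))
  have hP := twistedParity_extend (hδ := hδ₁) (hD := hD₁) h₁ hm₁
    (tmulB C.toDifferentialCalculus 1 f)
  rw [twistedParity_tmulB, C.parity_one, extend_one_tmulB h₁] at hP
  -- Expanding δ₁² h(f, k) = 0 gives h(D₁² f, k) + h(f, D₂² k) and two terms ±h(D₁ f, D₂ k), whose
  -- signs are opposite because D₁ f is odd.
  rw [key, map_add, key, key, extend_one_tmulB h₁, extend_one_tmulB h₂, hflat, hP,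
    twistedParity_tmulB, C.parity_one, extend_one_tmulB h₁] at e
  simpa using e

end Leibniz

/-! ### Dual bases -/

/-- A dual basis of a Hermitian module: `f = ∑ h(f, kᵢ) fᵢ`. -/
lemma exists_dual_basis : ∃ (m : ℕ) (e k : Fin m → F), ∀ f, f = ∑ i, H.pairing f (k i) • e i := by
  have := H.finite
  have := H.projective
  obtain ⟨m, p, hp⟩ := Module.Finite.exists_fin' B F
  obtain ⟨s, hs⟩ := Module.projective_lifting_property p LinearMap.id hp
  -- The coordinates of a splitting of Bᵐ → F are functionals on F, so the duality isomorphism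
  -- represents them as h(·, kᵢ).
  choose k hk using fun i => H.toDual_bijective.2 (LinearMap.proj i ∘ₗ s)
  refine ⟨m, fun i => p (Pi.single i 1), k, fun f => ?_⟩
  have h1 : p (s f) = f := LinearMap.congr_fun hs f
  have h2 : s f = ∑ i, (s f i) • (Pi.single i 1 : Fin m → B) := by
    ext j; simp [Finset.sum_apply, Pi.single_apply]
  conv_lhs => rw [← h1, h2, map_sum]
  refine Finset.sum_congr rfl fun i _ => ?_
  rw [map_smul, pairing, hk]
  rfl

variable {H} {m : ℕ} {e k : Fin m → F}

/-- A dual basis stays one after its two families are exchanged: pair with an arbitrary x, expand x,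
and use the Hermitian symmetry of h and the injectivity of `toDual`. -/
lemma eq_sum_pairing_smul (he : ∀ f, f = ∑ i, H.pairing f (k i) • e i) (f : F) :
    f = ∑ i, H.pairing f (e i) • k i := by
  apply H.toDual_bijective.1
  ext x
  change H.pairing x f = H.pairing x _
  have hsum : ∀ (s : Finset (Fin m)) (g : Fin m → F),
      H.pairing x (∑ i ∈ s, g i) = ∑ i ∈ s, H.pairing x (g i) := by
    intro s g
    exact map_sum (AddMonoidHom.mk' (fun y => H.pairing x y) (H.pairing_add_right x)) g s
  rw [hsum]
  conv_lhs => rw [he x]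
  simp only [pairing_smul_right]
  change H.toDual f _ = _
  rw [map_sum]
  refine Finset.sum_congr rfl fun i _ => ?_
  rw [map_smul, smul_eq_mul]
  congr 1
  exact H.symm _ _

lemma eq_sum_formPairing (he : ∀ f, f = ∑ i, H.pairing f (k i) • e i)
    (α : TwistedForms C.toDifferentialCalculus F) :
    α = ∑ i, tmulB C.toDifferentialCalculus
      (H.formPairing C α (tmulB C.toDifferentialCalculus 1 (k i))) (e i) := by
  have h1 : C.conj 1 = 1 := by simpa using C.conj_incl 1
  induction α using TwistedForms.induction with
  | hz => simp [tmulB_zero_left]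
  | ha α β h1 h2 =>
    simp only [map_add, LinearMap.add_apply, tmulB_add_left, Finset.sum_add_distrib, ← h1, ← h2]
  | ht ω f =>
    simp only [formPairing_tmulB, h1, mul_one, tmulB_smul]
    conv_lhs => rw [he f]
    simp only [tmulB]
    rw [TensorProduct.tmul_sum, map_sum]

-- Twisted forms are recovered from their pairings with a dual basis. This makes it possible to
-- check identities in Ω ⊗_B F within Ω.
variable (H) in
lemma eq_of_formPairing_eq {α β : TwistedForms C.toDifferentialCalculus F}
    (h : ∀ k, H.formPairing C α (tmulB C.toDifferentialCalculus 1 k) =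
      H.formPairing C β (tmulB C.toDifferentialCalculus 1 k)) : α = β := by
  obtain ⟨m, e, k, he⟩ := H.exists_dual_basis
  rw [eq_sum_formPairing he α, eq_sum_formPairing he β]
  simp only [h]

end HermitianModule

end Pairing

/-! ### Existence, uniqueness and type of the Chern connection. -/

section Chern

set_option linter.unusedSectionVars false

variable {B Ω : Type*} [Ring B] [StarRing B] [Algebra ℂ B] [StarModule ℂ B]
  [Ring Ω] [Algebra ℂ Ω] {C : DifferentialStarCalculus B Ω}
  {F : Type*} [AddCommGroup F] [Module B F] [Module ℂ F]

namespace ComplexStructure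

variable (K : ComplexStructure C)

lemma twistedBiproj_tmulB (p : ℕ × ℕ) (ω : Ω) (f : F) :
    K.twistedBiproj F p (tmulB C.toDifferentialCalculus ω f) =
      tmulB C.toDifferentialCalculus (K.biproj p ω) f := rfl

lemma twistedBiproj_mem (p : ℕ × ℕ) (α : TwistedForms C.toDifferentialCalculus F) :
    K.twistedBiproj F p α ∈ valuedIn C.toDifferentialCalculus F (K.bideg p) := by
  induction α using TwistedForms.induction with
  | hz => simp
  | ha α β h1 h2 => rw [map_add]; exact add_mem h1 h2
  | ht ω f => exact tmulB_mem_valuedIn (K.biproj_mem p ω) f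

lemma twistedBiproj_same {p : ℕ × ℕ} {α : TwistedForms C.toDifferentialCalculus F}
    (h : α ∈ valuedIn C.toDifferentialCalculus F (K.bideg p)) : K.twistedBiproj F p α = α := by
  refine valuedIn_induction (motive := fun α => K.twistedBiproj F p α = α) (by simp)
    (fun η hη f => ?_) (fun α β h1 h2 => ?_) h
  · rw [twistedBiproj_tmulB, K.biproj_same hη]
  · rw [map_add, h1, h2]

lemma twistedBiproj_ne {p q : ℕ × ℕ} (hpq : p ≠ q) {α : TwistedForms C.toDifferentialCalculus F}
    (h : α ∈ valuedIn C.toDifferentialCalculus F (K.bideg p)) : K.twistedBiproj F q α = 0 := by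
  refine valuedIn_induction (motive := fun α => K.twistedBiproj F q α = 0) (by simp)
    (fun η hη f => ?_) (fun α β h1 h2 => ?_) h
  · rw [twistedBiproj_tmulB, K.biproj_ne hη hpq, tmulB_zero_left]
  · rw [map_add, h1, h2, add_zero]

lemma bideg_one_zero_le : K.bideg (1, 0) ≤ C.deg 1 := K.bideg_le _

lemma bideg_zero_one_le : K.bideg (0, 1) ≤ C.deg 1 := K.bideg_le _

lemma biproj_add_biproj {ω : Ω} (h : ω ∈ C.deg 1) :
    K.biproj (1, 0) ω + K.biproj (0, 1) ω = ω := by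
  have hle : C.deg 1 ≤ LinearMap.eqLocus (K.biproj (1, 0) + K.biproj (0, 1)) LinearMap.id := by
    rw [K.deg_eq 1]
    refine iSup₂_le fun p hp ν hν => ?_
    change K.biproj (1, 0) ν + K.biproj (0, 1) ν = ν
    obtain ⟨a, b⟩ := p
    simp only at hp
    obtain ⟨rfl, rfl⟩ | ⟨rfl, rfl⟩ : (a = 1 ∧ b = 0) ∨ (a = 0 ∧ b = 1) := by omega
    · rw [K.biproj_same hν, K.biproj_ne hν (by simp), add_zero]
    · rw [K.biproj_same hν, K.biproj_ne hν (by simp), zero_add]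
  exact hle h

lemma twistedBiproj_add_twistedBiproj {α : TwistedForms C.toDifferentialCalculus F}
    (h : α ∈ valuedIn C.toDifferentialCalculus F (C.deg 1)) :
    K.twistedBiproj F (1, 0) α + K.twistedBiproj F (0, 1) α = α := by
  refine valuedIn_induction
    (motive := fun α => K.twistedBiproj F (1, 0) α + K.twistedBiproj F (0, 1) α = α) (by simp)
    (fun η hη f => ?_) (fun α β h1 h2 => ?_) h
  · rw [twistedBiproj_tmulB, twistedBiproj_tmulB, ← tmulB_add_left, K.biproj_add_biproj hη]
  · conv_rhs => rw [← h1, ← h2]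
    rw [map_add, map_add]; abel

end ComplexStructure

variable [IsScalarTower ℂ B F]

lemma HermitianModule.formPairing_mem (H : HermitianModule B F) (K : ComplexStructure C)
    {p : ℕ × ℕ} {α : TwistedForms C.toDifferentialCalculus F}
    (h : α ∈ valuedIn C.toDifferentialCalculus F (K.bideg p)) (k : F) :
    H.formPairing C α (tmulB C.toDifferentialCalculus 1 k) ∈ K.bideg p := by
  have h1 : C.conj 1 = 1 := by simpa using C.conj_incl 1
  refine valuedIn_induction (motive := fun α =>
    H.formPairing C α (tmulB C.toDifferentialCalculus 1 k) ∈ K.bideg p) (by simp)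
    (fun η hη f => ?_) (fun α β h1 h2 => ?_) h
  · rw [H.formPairing_tmulB, h1, mul_one]
    exact K.mul_incl_mem hη _
  · rw [map_add]; exact add_mem h1 h2

lemma HermitianModule.formPairing_mem' (H : HermitianModule B F) (K : ComplexStructure C)
    {p : ℕ × ℕ} {α : TwistedForms C.toDifferentialCalculus F}
    (h : α ∈ valuedIn C.toDifferentialCalculus F (K.bideg p)) (k : F) :
    H.formPairing C (tmulB C.toDifferentialCalculus 1 k) α ∈ K.bideg p.swap := by
  rw [← H.conj_formPairing]
  exact K.conj_mem_swap (H.formPairing_mem K h k)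

namespace HermitianHolomorphicModule

variable {K : ComplexStructure C} (E : HermitianHolomorphicModule K F)
  {D : F →ₗ[ℂ] TwistedForms C.toDifferentialCalculus F}

variable {E}

lemma IsChernConnection.eq_add (hD : E.IsChernConnection D) (f : F) :
    D f = K.twistedBiproj F (1, 0) (D f) + E.delbar f := by
  rw [← hD.proj_eq, K.twistedBiproj_add_twistedBiproj (hD.mem f)]

/-- The components of type `(1, 0)` and `(0, 1)` of the compatibility of a Chern connection with
the Hermitian pairing. -/
lemma IsChernConnection.hermitian_components (hD : E.IsChernConnection D) (f k : F) :
    K.del (C.incl (E.pairing f k)) =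
      E.formPairing C (K.twistedBiproj F (1, 0) (D f)) (tmulB C.toDifferentialCalculus 1 k) +
        E.formPairing C (tmulB C.toDifferentialCalculus 1 f) (E.delbar k) ∧
    K.delbar (C.incl (E.pairing f k)) =
      E.formPairing C (E.delbar f) (tmulB C.toDifferentialCalculus 1 k) +
        E.formPairing C (tmulB C.toDifferentialCalculus 1 f) (K.twistedBiproj F (1, 0) (D k)) := by
  have e := hD.hermitian f k
  rw [hD.eq_add f, hD.eq_add k, K.d_eq, LinearMap.add_apply, map_add, map_add,
    LinearMap.add_apply] at e
  have hb := K.incl_mem (E.pairing f k)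
  refine K.separate (p := (1, 0)) (q := (0, 1)) (by simp) (K.del_mem 0 0 _ hb)
    (add_mem (E.formPairing_mem K (K.twistedBiproj_mem _ _) _)
      (E.formPairing_mem' K (E.delbar_mem _) _)) (K.delbar_mem 0 0 _ hb)
    (add_mem (E.formPairing_mem K (E.delbar_mem _) _)
      (E.formPairing_mem' K (p := (1, 0)) (K.twistedBiproj_mem _ _) _)) ?_
  rw [e]; abel

/-- The (0, 1)-part is given, and the (1, 0) component of the Hermitian condition fixes h(∂_F f, 1 ⊗
k) for all k. -/
lemma IsChernConnection.unique {D' : F →ₗ[ℂ] TwistedForms C.toDifferentialCalculus F}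
    (hD : E.IsChernConnection D) (hD' : E.IsChernConnection D') : D = D' := by
  ext f
  rw [hD.eq_add, hD'.eq_add]
  congr 1
  refine E.eq_of_formPairing_eq fun k => ?_
  exact add_right_cancel ((hD.hermitian_components f k).1.symm.trans
    (hD'.hermitian_components f k).1)

variable (E)

/-- The form `∂ h(f, k) - h(1 ⊗ f, ∂̄ k)`, which is the pairing `h(∂ f, 1 ⊗ k)` of the
`(1, 0)`-part of the Chern connection. -/
def chernPairing (f k : F) : Ω :=
  K.del (C.incl (E.pairing f k)) - E.formPairing C (tmulB C.toDifferentialCalculus 1 f) (E.delbar k)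

lemma chernPairing_mem (f k : F) : E.chernPairing f k ∈ K.bideg (1, 0) :=
  sub_mem (K.del_mem 0 0 _ (K.incl_mem _)) (E.formPairing_mem' K (E.delbar_mem k) f)

lemma chernPairing_add_left (f f' k : F) :
    E.chernPairing (f + f') k = E.chernPairing f k + E.chernPairing f' k := by
  simp only [chernPairing, E.pairing_add_left, tmulB_add_right, map_add, LinearMap.add_apply]
  abel

lemma chernPairing_add_right (f k k' : F) :
    E.chernPairing f (k + k') = E.chernPairing f k + E.chernPairing f k' := by
  simp only [chernPairing, E.pairing_add_right, map_add]
  abel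

lemma chernPairing_smul_left' (c : ℂ) (f k : F) :
    E.chernPairing (c • f) k = c • E.chernPairing f k := by
  simp only [chernPairing, E.pairing_smul_left', tmulB_smul_right, map_smul, LinearMap.smul_apply,
    smul_sub]

lemma chernPairing_smul_left (b : B) (f k : F) : E.chernPairing (b • f) k =
    K.del (C.incl b) * C.incl (E.pairing f k) + C.incl b * E.chernPairing f k := by
  rw [chernPairing, E.pairing_smul_left, K.del_incl_mul, ← tmulB_smul, one_mul,
    E.formPairing_tmulB_left, chernPairing, mul_sub]
  abel

/-- The term h(f, k) ∂(b^*) from the Leibniz rule cancels against h(1 ⊗ f, ∂̄b ⊗ k), since (∂̄b)^* =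
∂(b^*). -/
lemma chernPairing_smul_right (b : B) (f k : F) :
    E.chernPairing f (b • k) = E.chernPairing f k * C.incl (star b) := by
  have h1 := E.formPairing_wedge_right (tmulB C.toDifferentialCalculus 1 f) (C.incl b)
    (valuedIn_mono K.bideg_zero_one_le (E.delbar_mem k))
  rw [C.parity_incl] at h1
  rw [chernPairing, E.pairing_smul_right, K.del_incl_mul, E.delbar_smul, map_add, h1,
    E.formPairing_tmulB, chernPairing, sub_mul, one_mul, (K.conj_del_delbar _).2, C.conj_incl]
  abel

/-- The `(1, 0)`-part of the Chern connection, in terms of a dual basis. -/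
def chernDel {m : ℕ} (e k : Fin m → F) : F →ₗ[ℂ] TwistedForms C.toDifferentialCalculus F where
  toFun f := ∑ i, tmulB C.toDifferentialCalculus (E.chernPairing f (k i)) (e i)
  map_add' f f' := by
    simp only [chernPairing_add_left, tmulB_add_left, Finset.sum_add_distrib]
  map_smul' c f := by
    simp only [chernPairing_smul_left', tmulB_smul_left, Finset.smul_sum, RingHom.id_apply]

variable {m : ℕ} {e k : Fin m → F}

lemma chernDel_apply (f : F) : E.chernDel e k f =
    ∑ i, tmulB C.toDifferentialCalculus (E.chernPairing f (k i)) (e i) := rfl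

lemma chernDel_mem (f : F) :
    E.chernDel e k f ∈ valuedIn C.toDifferentialCalculus F (K.bideg (1, 0)) := by
  rw [chernDel_apply]
  exact sum_mem fun _ _ => tmulB_mem_valuedIn (E.chernPairing_mem _ _) _

/-- `chernDel` prescribes the pairing only on the kᵢ. As `chernPairing` is conjugate B-linear in its
second variable, expanding x in the kᵢ gives the value for every x. -/
lemma formPairing_chernDel (he : ∀ f, f = ∑ i, E.pairing f (k i) • e i) (f x : F) :
    E.formPairing C (E.chernDel e k f) (tmulB C.toDifferentialCalculus 1 x) =
      E.chernPairing f x := by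
  have h1 : C.conj 1 = 1 := by simpa using C.conj_incl 1
  have hsum : ∀ g : Fin m → F, E.chernPairing f (∑ i, g i) = ∑ i, E.chernPairing f (g i) :=
    fun g => map_sum (AddMonoidHom.mk' (fun y => E.chernPairing f y) (E.chernPairing_add_right f)) g
      Finset.univ
  conv_rhs => rw [HermitianModule.eq_sum_pairing_smul he x, hsum]
  rw [chernDel_apply, map_sum, LinearMap.sum_apply]
  refine Finset.sum_congr rfl fun i _ => ?_
  rw [E.formPairing_tmulB, h1, mul_one, chernPairing_smul_right]
  congr 2
  exact E.symm _ _

lemma chernDel_smul (he : ∀ f, f = ∑ i, E.pairing f (k i) • e i) (b : B) (f : F) :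
    E.chernDel e k (b • f) = tmulB C.toDifferentialCalculus (K.del (C.incl b)) f +
      wedge C.toDifferentialCalculus F (C.incl b) (E.chernDel e k f) := by
  have h1 : C.conj 1 = 1 := by simpa using C.conj_incl 1
  refine E.eq_of_formPairing_eq fun x => ?_
  rw [map_add, LinearMap.add_apply, E.formPairing_chernDel he, E.formPairing_wedge_left,
    E.formPairing_chernDel he, E.chernPairing_smul_left, E.formPairing_tmulB, h1, mul_one]

lemma isChernConnection_chernDel_add (he : ∀ f, f = ∑ i, E.pairing f (k i) • e i) :
    E.IsChernConnection (E.chernDel e k + E.delbar) where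
  mem f := add_mem (valuedIn_mono K.bideg_one_zero_le (E.chernDel_mem f))
    (valuedIn_mono K.bideg_zero_one_le (E.delbar_mem f))
  leibniz b f := by
    rw [LinearMap.add_apply, E.chernDel_smul he, E.delbar_smul, K.d_eq, LinearMap.add_apply,
      LinearMap.add_apply, tmulB_add_left, map_add]
    abel
  hermitian f x := by
    have hs : ∀ f x, K.del (C.incl (E.pairing f x)) = E.formPairing C (E.chernDel e k f)
        (tmulB C.toDifferentialCalculus 1 x) +
        E.formPairing C (tmulB C.toDifferentialCalculus 1 f) (E.delbar x) := by
      intro f x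
      rw [E.formPairing_chernDel he, chernPairing, sub_add_cancel]
    -- The (0, 1) component of the Hermitian condition is the conjugate of the (1, 0) component with
    -- the two arguments interchanged.
    have h2 := congrArg C.conj (hs x f)
    rw [(K.conj_del_delbar _).1, C.conj_incl, map_add, E.conj_formPairing, E.conj_formPairing',
      show star (E.pairing x f) = E.pairing f x from (E.symm f x).symm] at h2
    rw [K.d_eq, LinearMap.add_apply, hs, h2]
    simp only [LinearMap.add_apply, map_add]
    abel
  proj_eq f := by
    rw [LinearMap.add_apply, map_add, K.twistedBiproj_ne (by simp) (E.chernDel_mem f),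
      K.twistedBiproj_same (E.delbar_mem f), zero_add]

lemma existsUnique_isChernConnection : ∃! D, E.IsChernConnection D := by
  obtain ⟨m, e, k, he⟩ := E.exists_dual_basis
  exact ⟨_, E.isChernConnection_chernDel_add he,
    fun D hD => hD.unique (E.isChernConnection_chernDel_add he)⟩

variable {E}

lemma IsChernConnection.del_smul (hD : E.IsChernConnection D) (b : B) (f : F) :
    (K.twistedBiproj F (1, 0) ∘ₗ D) (b • f) =
      tmulB C.toDifferentialCalculus (K.del (C.incl b)) f +
        wedge C.toDifferentialCalculus F (C.incl b) ((K.twistedBiproj F (1, 0) ∘ₗ D) f) := by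
  rw [LinearMap.comp_apply, hD.leibniz, map_add, K.twistedBiproj_wedge, K.twistedBiproj_tmulB,
    K.biproj_one_zero_d_incl, LinearMap.comp_apply]

lemma IsChernConnection.nabla_eq (hD : E.IsChernConnection D) :
    hD.nabla = hD.del + E.delbarExtension := by
  refine LinearMap.ext fun α => ?_
  induction α using TwistedForms.induction with
  | hz => simp
  | ha α β h1 h2 => rw [map_add, map_add, h1, h2]
  | ht ω f =>
    change tmulB _ (C.d ω) f + wedge _ F (C.parity ω) (D f) =
      (tmulB _ (K.del ω) f + wedge _ F (C.parity ω) (K.twistedBiproj F (1, 0) (D f))) +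
      (tmulB _ (K.delbar ω) f + wedge _ F (C.parity ω) (E.delbar f))
    conv_lhs => rw [hD.eq_add f, K.d_eq]
    rw [LinearMap.add_apply, tmulB_add_left, map_add]
    abel

lemma IsChernConnection.del_mem (_ : E.IsChernConnection D) (f : F) :
    (K.twistedBiproj F (1, 0) ∘ₗ D) f ∈ valuedIn C.toDifferentialCalculus F (C.deg 1) :=
  valuedIn_mono K.bideg_one_zero_le (K.twistedBiproj_mem _ _)

variable (E) in
lemma delbar_mem_deg_one (f : F) :
    E.delbar f ∈ valuedIn C.toDifferentialCalculus F (C.deg 1) :=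
  valuedIn_mono K.bideg_zero_one_le (E.delbar_mem f)

variable (E) in
lemma delbarExtension_delbarExtension (α : TwistedForms C.toDifferentialCalculus F) :
    E.delbarExtension (E.delbarExtension α) = 0 :=
  extend_extend K.isDifferential_delbar E.flat α

/-- The curvature has no (2, 0)-part: under h, that part is the counterpart of the (0, 2)-part,
which vanishes by flatness of ∂̄_F. -/
lemma IsChernConnection.del_del (hD : E.IsChernConnection D)
    (α : TwistedForms C.toDifferentialCalculus F) : hD.del (hD.del α) = 0 := by
  refine extend_extend K.isDifferential_del (fun f => ?_) α
  refine E.eq_of_formPairing_eq fun k => ?_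
  rw [map_zero, LinearMap.zero_apply]
  exact HermitianModule.formPairing_extend_eq_zero K.isDifferential_del K.isDifferential_delbar
    (fun ω => (K.conj_del_delbar ω).2.symm) hD.del_mem E.delbar_mem_deg_one
    (fun f k => (hD.hermitian_components f k).1) E.flat f k

end HermitianHolomorphicModule

end Chern

/-! ### Integration by parts and adjoints. -/

section Adjoints

set_option linter.unusedSectionVars false

variable {B Ω : Type*} [Ring B] [StarRing B] [Algebra ℂ B] [StarModule ℂ B]
  [Ring Ω] [Algebra ℂ Ω] {C : DifferentialStarCalculus B Ω} {n : ℕ}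
  (K : HermitianStructure C n)
  {F : Type*} [AddCommGroup F] [Module B F] [Module ℂ F]

lemma HermitianStructure.integral_eq_zero (φ : State B) {p : ℕ × ℕ} (hp : p ≠ (n, n)) {ω : Ω}
    (h : ω ∈ K.bideg p) : K.integral φ ω = 0 := by
  change φ.toLinearMap (C.toBase (K.hodge ω)) = 0
  rw [K.toBase_hodge_eq_zero hp h, map_zero]

/-- The integral sees only bidegree (n, n), and for bihomogeneous ω at most one of ∂ω and ∂̄ω lies
there. Closedness for d thus splits into closedness for each half. -/
lemma HermitianStructure.IntegralClosed.integral_del_delbar {K : HermitianStructure C n}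
    {φ : State B} (hφ : K.IntegralClosed φ) (ω : Ω) :
    K.integral φ (K.del ω) = 0 ∧ K.integral φ (K.delbar ω) = 0 := by
  induction ω using K.toComplexStructure.induction with
  | hz => simp
  | ha ω ν h1 h2 => simp [h1, h2]
  | hb p ω h =>
    obtain ⟨a, b⟩ := p
    have m1 := K.del_mem _ _ _ h
    have m2 := K.delbar_mem _ _ _ h
    by_cases hab : a + b + 1 = 2 * n
    · have e := hφ (a + b) hab ω (K.bideg_le _ h)
      rw [K.d_eq, LinearMap.add_apply, map_add] at e
      by_cases h1 : (a + 1, b) = (n, n)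
      · have h2 : (a, b + 1) ≠ (n, n) := by
          simp only [ne_eq, Prod.mk.injEq] at h1 ⊢; omega
        have e2 := K.integral_eq_zero φ h2 m2
        rw [e2, add_zero] at e
        exact ⟨e, e2⟩
      · have e1 := K.integral_eq_zero φ h1 m1
        rw [e1, zero_add] at e
        exact ⟨e1, e⟩
    · refine ⟨K.integral_eq_zero φ ?_ m1, K.integral_eq_zero φ ?_ m2⟩
      · simp only [ne_eq, Prod.mk.injEq]; omega
      · simp only [ne_eq, Prod.mk.injEq]; omega

variable (F) in
/-- The Hodge map on `Ω ⊗_B F`. -/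
def HermitianStructure.twistedHodge : Module.End ℂ (TwistedForms C.toDifferentialCalculus F) :=
  mapB C.toDifferentialCalculus F K.hodge K.hodge_mul_incl

lemma HermitianStructure.twistedHodge_mul_twistedHodge :
    K.twistedHodge F * K.twistedHodge F = twistedParity C.toDifferentialCalculus F := by
  refine LinearMap.ext fun α => ?_
  induction α using TwistedForms.induction with
  | hz => simp
  | ha α β h1 h2 => rw [map_add, map_add, h1, h2]
  | ht ω f =>
    change tmulB _ (K.hodge (K.hodge ω)) f = tmulB _ (C.parity ω) f
    rw [K.hodge_hodge]

variable [IsScalarTower ℂ B F] {H : HermitianModule B F}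

lemma HermitianModule.inner_eq (φ : State B) (α β : TwistedForms C.toDifferentialCalculus F) :
    H.inner K φ α β = K.integral φ (H.formPairing C α (K.twistedHodge F β)) := by
  change φ.toLinearMap _ = φ.toLinearMap (C.toBase (K.hodge _))
  congr 1
  induction α using TwistedForms.induction with
  | hz => simp
  | ha α α' h1 h2 => simp only [map_add, LinearMap.add_apply, h1, h2]
  | ht ω f =>
    induction β using TwistedForms.induction with
    | hz => simp
    | ha β β' h1 h2 => simp only [map_add, h1, h2]
    | ht ν k => exact K.metric_eq _ _

lemma HermitianModule.integral_formPairing_twistedParity (φ : State B)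
    (α β : TwistedForms C.toDifferentialCalculus F) :
    K.integral φ (H.formPairing C (twistedParity C.toDifferentialCalculus F α) β) =
      K.integral φ (H.formPairing C α (twistedParity C.toDifferentialCalculus F β)) := by
  change φ.toLinearMap (C.toBase (K.hodge _)) = φ.toLinearMap (C.toBase (K.hodge _))
  congr 1
  induction α using TwistedForms.induction with
  | hz => simp
  | ha α α' h1 h2 => simp only [map_add, LinearMap.add_apply, h1, h2]
  | ht ω f =>
    induction β using TwistedForms.induction with
    | hz => simp
    | ha β β' h1 h2 => simp only [map_add, h1, h2]
    | ht ν k =>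
      rw [twistedParity_tmulB, twistedParity_tmulB, H.formPairing_tmulB, H.formPairing_tmulB,
        ← C.parity_incl (H.pairing f k), ← C.parity_mul, C.parity_incl,
        K.toBase_hodge_parity_mul]

lemma HermitianModule.inner_sub_right (φ : State B)
    (α β γ : TwistedForms C.toDifferentialCalculus F) :
    H.inner K φ α (β - γ) = H.inner K φ α β - H.inner K φ α γ := by
  simp only [inner, map_sub]

/-- Adjoints are unique if the pairing is non-degenerate. -/
lemma IsAdjoint.eq {φ : State B}
    (hnd : ∀ β : TwistedForms C.toDifferentialCalculus F, (∀ α, H.inner K φ α β = 0) → β = 0)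
    {T S S' : Module.End ℂ (TwistedForms C.toDifferentialCalculus F)}
    (h : IsAdjoint (H.inner K φ) T S) (h' : IsAdjoint (H.inner K φ) T S') : S = S' := by
  refine LinearMap.ext fun β => sub_eq_zero.1 (hnd _ fun α => ?_)
  rw [H.inner_sub_right, ← h, ← h', sub_self]

lemma IsAdjoint.add {φ : State B}
    {T T' S S' : Module.End ℂ (TwistedForms C.toDifferentialCalculus F)}
    (h : IsAdjoint (H.inner K φ) T S) (h' : IsAdjoint (H.inner K φ) T' S') :
    IsAdjoint (H.inner K φ) (T + T') (S + S') := by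
  intro α β
  have e1 := h α β
  have e2 := h' α β
  simp only [HermitianModule.inner, LinearMap.add_apply, map_add] at *
  rw [e1, e2]

section extend

variable {K} {δ₁ δ₂ : Ω →ₗ[ℂ] Ω}
  {hδ₁ : ∀ ω b, δ₁ (ω * C.incl b) = δ₁ ω * C.incl b + C.parity ω * δ₁ (C.incl b)}
  {hδ₂ : ∀ ω b, δ₂ (ω * C.incl b) = δ₂ ω * C.incl b + C.parity ω * δ₂ (C.incl b)}
  {D₁ D₂ : F →ₗ[ℂ] TwistedForms C.toDifferentialCalculus F}
  {hD₁ : ∀ b f, D₁ (b • f) = tmulB C.toDifferentialCalculus (δ₁ (C.incl b)) f +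
    wedge C.toDifferentialCalculus F (C.incl b) (D₁ f)}
  {hD₂ : ∀ b f, D₂ (b • f) = tmulB C.toDifferentialCalculus (δ₂ (C.incl b)) f +
    wedge C.toDifferentialCalculus F (C.incl b) (D₂ f)}

/-- Integration by parts: ∫ δ₁ h(α, *β) = 0 expands to ⟨D₁α, β⟩ plus ∫ h(Pα, D₂ * β), with P the
parity. Moving P = * * to the second variable turns the latter into ⟨α, * D₂ * β⟩. -/
lemma isAdjoint_extend {φ : State B} (h₁ : C.IsDifferential δ₁)
    (hconj : ∀ ω, δ₁ (C.conj ω) = C.conj (δ₂ ω))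
    (hm : ∀ f, D₂ f ∈ valuedIn C.toDifferentialCalculus F (C.deg 1))
    (hH : ∀ f k, δ₁ (C.incl (H.pairing f k)) =
      H.formPairing C (D₁ f) (tmulB C.toDifferentialCalculus 1 k) +
        H.formPairing C (tmulB C.toDifferentialCalculus 1 f) (D₂ k))
    (hint : ∀ ω, K.integral φ (δ₁ ω) = 0) :
    IsAdjoint (H.inner K φ) (extend C.toDifferentialCalculus δ₁ hδ₁ D₁ hD₁)
      (-(K.twistedHodge F * extend C.toDifferentialCalculus δ₂ hδ₂ D₂ hD₂ * K.twistedHodge F)) := by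
  intro α β
  have hHH : ∀ γ, K.twistedHodge F (K.twistedHodge F γ) =
      twistedParity C.toDifferentialCalculus F γ :=
    fun γ => LinearMap.congr_fun K.twistedHodge_mul_twistedHodge γ
  have e := hint (H.formPairing C α (K.twistedHodge F β))
  rw [HermitianModule.map_formPairing (hδ₁ := hδ₁) (hδ₂ := hδ₂) (hD₁ := hD₁) (hD₂ := hD₂) h₁ hconj
    hm hH, map_add, H.integral_formPairing_twistedParity] at e
  rw [H.inner_eq, H.inner_eq, LinearMap.neg_apply, map_neg, map_neg, map_neg,
    Module.End.mul_apply, Module.End.mul_apply, hHH]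
  exact eq_neg_of_add_eq_zero_left e

/-- The inner * * is the parity operator, which anticommutes with the extended D₂, so the square
contains D₂² = 0. -/
lemma hodge_extend_hodge_sq (h₂ : C.IsDifferential δ₂)
    (hm : ∀ f, D₂ f ∈ valuedIn C.toDifferentialCalculus F (C.deg 1))
    (h0 : ∀ α, extend C.toDifferentialCalculus δ₂ hδ₂ D₂ hD₂
      (extend C.toDifferentialCalculus δ₂ hδ₂ D₂ hD₂ α) = 0) :
    (-(K.twistedHodge F * extend C.toDifferentialCalculus δ₂ hδ₂ D₂ hD₂ * K.twistedHodge F) :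
      Module.End ℂ (TwistedForms C.toDifferentialCalculus F)) *
      (-(K.twistedHodge F * extend C.toDifferentialCalculus δ₂ hδ₂ D₂ hD₂ * K.twistedHodge F)) =
      0 := by
  refine LinearMap.ext fun α => ?_
  have hHH : ∀ γ, K.twistedHodge F (K.twistedHodge F γ) =
      twistedParity C.toDifferentialCalculus F γ :=
    fun γ => LinearMap.congr_fun K.twistedHodge_mul_twistedHodge γ
  have hP := twistedParity_extend (hδ := hδ₂) (hD := hD₂) h₂ hm
  simp only [Module.End.mul_apply, LinearMap.neg_apply, map_neg, neg_neg, LinearMap.zero_apply]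
  rw [hHH, ← neg_inj, ← map_neg, ← hP, h0, map_zero, map_zero, neg_zero]

end extend

end Adjoints

/-! ### The Laplacians -/

section Laplacians

variable {R : Type*} [Ring R] [Algebra ℂ R]

/-- To be read with a = ∂_F, b = ∂̄_F, l = Λ, x = * ∂̄_F * and y = * ∂_F *. The relations for x and
y express a' and b' as multiples of [l, b] and [l, a]; after substitution, only a² = b² = 0 is
needed to compare words in a, b, l. -/
lemma laplacian_identities {a b a' b' l x y : R} (ha : a * a = 0) (hb : b * b = 0)
    (ha' : a' * a' = 0) (hb' : b' * b' = 0) (hax : a' = -x) (hby : b' = -y)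
    (hlb : l * b - b * l = Complex.I • x) (hla : l * a - a * l = (-Complex.I) • y) :
    ((a + b) * (a' + b') + (a' + b') * (a + b) = (a + a') ^ 2 + (b + b') ^ 2) ∧
    ((a + b) * (a' + b') + (a' + b') * (a + b) =
      (2 : ℂ) • (a + a') ^ 2 - ⁅l, Complex.I • (a + b) ^ 2⁆) ∧
    ((a + b) * (a' + b') + (a' + b') * (a + b) =
      (2 : ℂ) • (b + b') ^ 2 + ⁅l, Complex.I • (a + b) ^ 2⁆) := by
  have ea : (a + a') ^ 2 = a * a' + a' * a := by
    rw [sq, add_mul, mul_add, mul_add, ha, ha']; abel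
  have eb : (b + b') ^ 2 = b * b' + b' * b := by
    rw [sq, add_mul, mul_add, mul_add, hb, hb']; abel
  have eab : (a + b) ^ 2 = a * b + b * a := by
    rw [sq, add_mul, mul_add, mul_add, ha, hb]; abel
  have fa : a' = Complex.I • (l * b - b * l) := by
    rw [hlb, smul_smul, Complex.I_mul_I, hax, neg_one_smul]
  have fb : b' = -(Complex.I • (l * a - a * l)) := by
    rw [hla, neg_smul, smul_neg, smul_smul, Complex.I_mul_I, hby, neg_one_smul, neg_neg]
  have haa : ∀ z, a * (a * z) = 0 := fun z => by rw [← mul_assoc, ha, zero_mul]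
  have hbb : ∀ z, b * (b * z) = 0 := fun z => by rw [← mul_assoc, hb, zero_mul]
  rw [ea, eb, eab, fa, fb, Ring.lie_def]
  simp only [add_mul, mul_add, mul_sub, sub_mul, smul_add, smul_sub, mul_smul_comm, smul_mul_assoc,
    mul_assoc, mul_neg, neg_mul, ha, hb, haa, hbb, mul_zero, smul_zero]
  refine ⟨?_, ?_, ?_⟩ <;> module

end Laplacians

/-! ### The Kähler identities for forms with values in a module. -/

section Kaehler

set_option linter.unusedSectionVars false

variable {B Ω : Type*} [Ring B] [StarRing B] [Algebra ℂ B] [StarModule ℂ B]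
  [Ring Ω] [Algebra ℂ Ω] {C : DifferentialStarCalculus B Ω} {n : ℕ}

/-- The forms ∂κ and ∂̄κ have different bidegrees, so dκ = 0 kills both, and κ has even degree. -/
lemma KaehlerStructure.del_delbar_kappa_mul (K : KaehlerStructure C n) (ω : Ω) :
    K.del (K.κ * ω) = K.κ * K.del ω ∧ K.delbar (K.κ * ω) = K.κ * K.delbar ω := by
  have e : K.del K.κ + K.delbar K.κ = 0 + 0 := by
    rw [← LinearMap.add_apply, ← K.d_eq, K.κ_closed, add_zero]
  have h := K.separate (by simp) (K.del_mem _ _ _ K.κ_mem) (zero_mem _)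
    (K.delbar_mem _ _ _ K.κ_mem) (zero_mem _) e
  rw [(K.del_delbar_mul _ _).1, (K.del_delbar_mul _ _).2, h.1, h.2, K.parity_kappa]
  simp

variable {F : Type*} [AddCommGroup F] [Module B F] [Module ℂ F] [IsScalarTower ℂ B F]
  (K : KaehlerStructure C n)

/-- The Kähler identity `[Λ, ∂̄_F] = i * ∂̄_F *`. -/
lemma KaehlerStructure.twistedDualLefschetz_delbar
    (E : HermitianHolomorphicModule K.toComplexStructure F) :
    K.twistedDualLefschetz F * E.delbarExtension - E.delbarExtension * K.twistedDualLefschetz F =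
      Complex.I • (K.twistedHodge F * E.delbarExtension * K.twistedHodge F) := by
  refine LinearMap.ext fun α => mapB_extend_commutator (W := K.bideg (0, 1))
    (hδ := fun ω b => (K.del_delbar_mul_incl ω b).2) (hD := E.delbar_smul)
    (fun ω => K.dualLefschetz_commutator_of_zero_one K.delbar_mem
      (fun ω => (K.del_delbar_kappa_mul ω).2) ω)
    -- Wedging with η on the right, with the parity sign, also has bidegree (0, 1) and commutes with
    -- left multiplication by κ, so the same scalar identity applies.
    (fun η hη ω => K.dualLefschetz_commutator_of_zero_one
      (T := LinearMap.mulRight ℂ η ∘ₗ C.parity) (fun a b ν hν => ?_) (fun ν => ?_) ω)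
    E.delbar_mem α
  · simpa using K.mul_mem (K.parity_mem hν) hη
  · simp [C.parity_mul, K.parity_kappa, mul_assoc]

/-- The Kähler identity `[Λ, ∂_F] = -i * ∂_F *`. -/
lemma KaehlerStructure.twistedDualLefschetz_del
    {E : HermitianHolomorphicModule K.toComplexStructure F}
    {D : F →ₗ[ℂ] TwistedForms C.toDifferentialCalculus F} (hD : E.IsChernConnection D) :
    K.twistedDualLefschetz F * hD.del - hD.del * K.twistedDualLefschetz F =
      (-Complex.I) • (K.twistedHodge F * hD.del * K.twistedHodge F) := by
  refine LinearMap.ext fun α => mapB_extend_commutator (W := K.bideg (1, 0))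
    (hδ := fun ω b => (K.del_delbar_mul_incl ω b).1) (hD := hD.del_smul)
    (fun ω => ?_) (fun η hη ω => ?_) (fun f => K.twistedBiproj_mem _ _) α
  · rw [neg_smul]
    exact K.dualLefschetz_commutator_of_one_zero K.del_mem
      (fun ω => (K.del_delbar_kappa_mul ω).1) ω
  · rw [neg_smul]
    refine K.dualLefschetz_commutator_of_one_zero
      (T := LinearMap.mulRight ℂ η ∘ₗ C.parity) (fun a b ν hν => ?_) (fun ν => ?_) ω
    · simpa using K.mul_mem (K.parity_mem hν) hη
    · simp [C.parity_mul, K.parity_kappa, mul_assoc]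

end Kaehler

end NCGeom

end

theorem mainTheorem5 {B Ω F : Type*} [Ring B] [StarRing B] [Algebra ℂ B] [StarModule ℂ B]
    [Ring Ω] [Algebra ℂ Ω] [AddCommGroup F] [Module B F] [Module ℂ F] [IsScalarTower ℂ B F]
    {C : NCGeom.DifferentialStarCalculus B Ω} {n : ℕ} (K : NCGeom.KaehlerStructure C n)
    (E : NCGeom.HermitianHolomorphicModule K.toComplexStructure F)
    (φ : NCGeom.State B) (hφ : K.IntegralClosed φ) :
    -- `Λ` is an adjoint of `L` with respect to the `B`-valued metric on forms
    (∀ ω ν, K.metric (K.lefschetz ω) ν = K.metric ω (K.dualLefschetz ν)) ∧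
    -- the Chern connection exists and is unique
    (∃! D, E.IsChernConnection D) ∧
    ∀ D, ∀ hD : E.IsChernConnection D,
      ∃ nablaAdj delAdj delbarAdj :
          Module.End ℂ (NCGeom.TwistedForms C.toDifferentialCalculus F),
        NCGeom.IsAdjoint (E.inner K.toHermitianStructure φ) hD.nabla nablaAdj ∧
        NCGeom.IsAdjoint (E.inner K.toHermitianStructure φ) hD.del delAdj ∧
        NCGeom.IsAdjoint (E.inner K.toHermitianStructure φ) E.delbarExtension delbarAdj ∧
        nablaAdj = delAdj + delbarAdj ∧
        -- if the pairing is non-degenerate, then these are the only adjoints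
        ((∀ β, (∀ α, E.inner K.toHermitianStructure φ α β = 0) → β = 0) → ∀ T,
          (NCGeom.IsAdjoint (E.inner K.toHermitianStructure φ) hD.nabla T → T = nablaAdj) ∧
          (NCGeom.IsAdjoint (E.inner K.toHermitianStructure φ) hD.del T → T = delAdj) ∧
          (NCGeom.IsAdjoint (E.inner K.toHermitianStructure φ) E.delbarExtension T →
            T = delbarAdj)) ∧
        -- the Weitzenböck identities for the Laplacians
        hD.nabla * nablaAdj + nablaAdj * hD.nabla =
          (hD.del + delAdj) ^ 2 + (E.delbarExtension + delbarAdj) ^ 2 ∧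
        hD.nabla * nablaAdj + nablaAdj * hD.nabla =
          (2 : ℂ) • (hD.del + delAdj) ^ 2 - ⁅K.twistedDualLefschetz F, Complex.I • hD.nabla ^ 2⁆ ∧
        hD.nabla * nablaAdj + nablaAdj * hD.nabla =
          (2 : ℂ) • (E.delbarExtension + delbarAdj) ^ 2 +
            ⁅K.twistedDualLefschetz F, Complex.I • hD.nabla ^ 2⁆ := by
  refine ⟨K.metric_lefschetz, E.existsUnique_isChernConnection, fun D hD => ?_⟩
  -- The adjoint of ∂_F is built from ∂̄_F, and below that of ∂̄_F from ∂_F, as conjugation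
  -- exchanges ∂ and ∂̄.
  have hdel : NCGeom.IsAdjoint (E.inner K.toHermitianStructure φ) hD.del
      (-(K.twistedHodge F * E.delbarExtension * K.twistedHodge F)) :=
    NCGeom.isAdjoint_extend (hδ₁ := fun ω b => (K.del_delbar_mul_incl ω b).1) (hD₁ := hD.del_smul)
      (hδ₂ := fun ω b => (K.del_delbar_mul_incl ω b).2) (hD₂ := E.delbar_smul)
      K.isDifferential_del (fun ω => (K.conj_del_delbar ω).2.symm)
      E.delbar_mem_deg_one (fun f k => (hD.hermitian_components f k).1)
      (fun ω => (hφ.integral_del_delbar ω).1)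
  have hdelbar : NCGeom.IsAdjoint (E.inner K.toHermitianStructure φ) E.delbarExtension
      (-(K.twistedHodge F * hD.del * K.twistedHodge F)) :=
    NCGeom.isAdjoint_extend (hδ₁ := fun ω b => (K.del_delbar_mul_incl ω b).2) (hD₁ := E.delbar_smul)
      (hδ₂ := fun ω b => (K.del_delbar_mul_incl ω b).1) (hD₂ := hD.del_smul)
      K.isDifferential_delbar (fun ω => (K.conj_del_delbar ω).1.symm)
      hD.del_mem (fun f k => (hD.hermitian_components f k).2)
      (fun ω => (hφ.integral_del_delbar ω).2)
  have hnabla := NCGeom.IsAdjoint.add K.toHermitianStructure hdel hdelbar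
  rw [← hD.nabla_eq] at hnabla
  refine ⟨_, _, _, hnabla, hdel, hdelbar, rfl, fun hnd T => ⟨fun h => ?_, fun h => ?_, fun h => ?_⟩,
    ?_⟩
  · exact NCGeom.IsAdjoint.eq _ hnd h hnabla
  · exact NCGeom.IsAdjoint.eq _ hnd h hdel
  · exact NCGeom.IsAdjoint.eq _ hnd h hdelbar
  · rw [hD.nabla_eq]
    exact NCGeom.laplacian_identities (LinearMap.ext hD.del_del)
      (LinearMap.ext E.delbarExtension_delbarExtension)
      (NCGeom.hodge_extend_hodge_sq
        (hδ₂ := fun ω b => (K.del_delbar_mul_incl ω b).2) (hD₂ := E.delbar_smul)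
        K.isDifferential_delbar E.delbar_mem_deg_one
        E.delbarExtension_delbarExtension)
      (NCGeom.hodge_extend_hodge_sq
        (hδ₂ := fun ω b => (K.del_delbar_mul_incl ω b).1) (hD₂ := hD.del_smul)
        K.isDifferential_del hD.del_mem hD.del_del) rfl rfl
      (K.twistedDualLefschetz_delbar E) (K.twistedDualLefschetz_del hD)
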